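/- Let $n\ge 1$ and let $\Lambda=\mathbb C[p_1,p_2,\dots]$ be the ring of symmetric functions over $\mathbb C$ (in $x_1,x_2,\dots$), with power sums $p_i$, complete symmetric functions $h_k$ ($h_0=1$, $h_k=0$ for $k<0$), Schur functions $s_\lambda=\det(h_{\lambda_i+j-i})$ and the bilinear Hall inner product. For $f\in\Lambda$ let $f^\perp$ be the adjoint of multiplication by $f$. Let $g_\lambda=\det\bigl(\sum_{m\ge0}(-1)^m\binom{1-i}{m}h_{\lambda_i+j-i-m}\bigr)_{1\le i,j\le\ell(\lambda)}$ be the dual stable Grothendieck polynomials, $R_d$ the rectangle with $d$ rows and $n-d$ columns, and $\Lambda_{(n)}=\mathbb C[h_1,\dots,h_{n-1}]\subset\Lambda$. Let $\kappa_d:\Lambda\to\Lambda$ be the $\mathbb C$-algebra homomorphism with $\kappa_d(p_i)=d-\binom i1p_1+\binom i2p_2-\dots+(-1)^i\binom ii p_i$ (that is, the substitution $x_j\mapsto1-x_j$ for $1\le j\le d$). In $\Lambda_{(n)}[\zeta]/((\zeta-1)^n)$ put $\varphi=\sum_{k=0}^{n-1}(-1)^kh_k(\zeta-1)^k$. Let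 $\mathbf c(f)$ be the column of coordinates of $f$ in the basis $1,\zeta-1,\dots,(\zeta-1)^{n-1}$, so that $|\mathbf c(1),\mathbf c(\zeta),\dots,\mathbf c(\zeta^{n-1})|=1$. With $\mathbf a_j=\mathbf c(\zeta^j)$ and $\mathbf b_j=\mathbf c(\zeta^j\varphi)$ define $$\tau_i=|\mathbf b_0,\dots,\mathbf b_{i-1},\mathbf a_{i-1},\dots,\mathbf a_{n-2}|,\qquad \sigma_i=|\mathbf b_0,\dots,\mathbf b_{i-1},\mathbf a_i,\dots,\mathbf a_{n-1}|\qquad(1\le i\le n),$$ $\tau_0=\sigma_0=1$, and for integers $\theta_1,\dots,\theta_d$ $$D(\theta_1,\dots,\theta_d)=|\mathbf c(\zeta^{-\theta_1}\varphi),\dots,\mathbf c(\zeta^{-\theta_d}\varphi),\mathbf c(1),\mathbf c(\zeta),\dots,\mathbf c(\zeta^{n-d-1})|\in\Lambda_{(n)}.$$ With $Q_n=0$, for $1\le m\le n$ and $k\in\mathbb Z$ let $$F^{(m)}_k=\sum_{I\subset\{1,\dots,m\},\ \#I=k}\ \prod_{j\in I}z_j\prod_{j\in I,\ j+1\notin I}(1-Q_j)\in\mathbb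 C[z_1,\dots,z_n,Q_1,\dots,Q_{n-1}]$$ (so $F^{(m)}_k=0$ for $k<0$). Let $A_n=\bigl(\mathbb C[z,Q]/\langle F^{(n)}_i-\binom ni\ (1\le i\le n)\rangle\bigr)[Q_1^{-1},\dots,Q_{n-1}^{-1}]$ and $B_n=\Lambda_{(n)}[\tau_i^{-1},\sigma_i^{-1}\ (1\le i\le n-1)]$. The $K$-theoretic Peterson map, i.e. the $\mathbb C$-algebra homomorphism $\Phi_n:A_n\to B_n$ with $$\Phi_n(z_i)=\frac{\tau_i\sigma_{i-1}}{\sigma_i\tau_{i-1}}\ (1\le i\le n),\qquad \Phi_n(Q_i)=\frac{\tau_{i-1}\tau_{i+1}}{\tau_i^2}\ (1\le i\le n-1),$$ is well defined (all these denominators are invertible in $B_n$), and for every $1\le d\le n$ and every partition $\lambda\subset R_d$ the following holds. Put $i_a=\lambda_{d+1-a}+a$ for $1\le a\le d$, let $\lambda'$ be the conjugate partition and let $S^Q_{\lambda,d}=\det\bigl(F^{(d+j-1)}_{\lambda'_i-i+j}\bigr)_{1\le i,j\le\ell(\lambda')}$. Then 1. $\displaystyle \Phi_n(S^Q_{\lambda,d})=\frac{D(d-i_1,d-i_2,\dots,d-i_d)}{D(d-1,d-2,\dots,0)}$;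 2. $\kappa_d(s_\lambda)^\perp\cdot g_{R_d}=D(d-i_1,d-i_2,\dots,d-i_d)$; 3. $\displaystyle \Phi_n(S^Q_{\lambda,d})=\frac{\kappa_d(s_\lambda)^\perp\cdot g_{R_d}}{g_{R_d}}$, where the numerator and the denominator lie in $\Lambda_{(n)}$ and the denominator is invertible in $B_n$. -/

import Mathlib

open scoped BigOperators

noncomputable section

namespace KPeterson

/-! ### The ring of symmetric functions over the complex numbers -/

/-- The ring `Λ` of symmetric functions with complex coefficients, presented as the polynomial
ring on the power sums `p_1, p_2, p_3, …`: the variable `X i` is the power sum `p_i`. -/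
abbrev Lam : Type := MvPolynomial ℕ+ ℂ

/-- The power sum `p_i`, for `i ≥ 1` (and the value `0` at the unused index `0`). -/
def psum (i : ℕ) : Lam := if hi : 0 < i then MvPolynomial.X ⟨i, hi⟩ else 0

/-- The complete symmetric function `h_k`, from the power sums by Newton's identities
`h_0 = 1` and `k h_k = ∑_{i = 1}^{k} p_i h_{k-i}`. -/
def complete : ℕ → Lam
  | 0 => 1
  | k + 1 => MvPolynomial.C (1 / ((k : ℂ) + 1)) *
      ∑ i : Fin (k + 1), psum ((i : ℕ) + 1) * complete (k - (i : ℕ))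
  decreasing_by omega

/-- `h_k` for an integer `k`, with `h_k = 0` for `k < 0`. -/
def completeInt (k : ℤ) : Lam := if k < 0 then 0 else complete k.toNat

/-- The number `z_m = ∏_i i^{m_i} m_i!` attached to the power sum monomial
`p^m = ∏_i p_i^{m_i}`. -/
def zNumber (m : ℕ+ →₀ ℕ) : ℂ := m.prod fun i e => ((i : ℕ) : ℂ) ^ e * (e.factorial : ℂ)

/-- The (bilinear) Hall inner product on `Λ`: `⟨p^m, p^l⟩ = z_m` if `m = l`, and `0` otherwise. -/
def hall : Lam →ₗ[ℂ] Lam →ₗ[ℂ] ℂ :=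
  (MvPolynomial.basisMonomials ℕ+ ℂ).constr ℂ fun m => zNumber m • MvPolynomial.lcoeff ℂ m

/-- `perp f g = f^⊥ · g`, where `f^⊥` is the adjoint of multiplication by `f` for the Hall inner
product (see `hall_perp` and `perp_unique`). On power sum monomials,
`(p^a)^⊥ · p^b = (z_b / z_{b-a}) p^{b-a}` if `a ≤ b`, and `0` otherwise. -/
def perp : Lam →ₗ[ℂ] Lam →ₗ[ℂ] Lam :=
  (MvPolynomial.basisMonomials ℕ+ ℂ).constr ℂ fun a =>
    (MvPolynomial.basisMonomials ℕ+ ℂ).constr ℂ fun b =>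
      open Classical in
      if a ≤ b then MvPolynomial.monomial (b - a) (zNumber b / zNumber (b - a)) else 0

theorem zNumber_ne_zero (m : ℕ+ →₀ ℕ) : zNumber m ≠ 0 := by
  unfold zNumber Finsupp.prod
  refine Finset.prod_ne_zero_iff.mpr fun i _ => mul_ne_zero (pow_ne_zero _ ?_) ?_
  · exact_mod_cast i.ne_zero
  · exact_mod_cast (m i).factorial_ne_zero

theorem hall_monomial (m : ℕ+ →₀ ℕ) (u : Lam) :
    hall (MvPolynomial.monomial m 1) u = zNumber m * MvPolynomial.coeff m u := by
  have h := (MvPolynomial.basisMonomials ℕ+ ℂ).constr_basis ℂ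
    (fun m => zNumber m • MvPolynomial.lcoeff ℂ m) m
  rw [MvPolynomial.coe_basisMonomials] at h
  rw [hall, h]
  simp

theorem perp_monomial (a b : ℕ+ →₀ ℕ) :
    perp (MvPolynomial.monomial a 1) (MvPolynomial.monomial b 1) =
      open Classical in
      if a ≤ b then MvPolynomial.monomial (b - a) (zNumber b / zNumber (b - a)) else 0 := by
  classical
  have h := (MvPolynomial.basisMonomials ℕ+ ℂ).constr_basis ℂ
    (fun a => (MvPolynomial.basisMonomials ℕ+ ℂ).constr ℂ fun b =>
      (if a ≤ b then MvPolynomial.monomial (b - a) (zNumber b / zNumber (b - a)) else 0 : Lam)) a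
  have h2 := (MvPolynomial.basisMonomials ℕ+ ℂ).constr_basis ℂ
    (fun b =>
      (if a ≤ b then MvPolynomial.monomial (b - a) (zNumber b / zNumber (b - a)) else 0 : Lam)) b
  rw [MvPolynomial.coe_basisMonomials] at h h2
  rw [perp, h, h2]

/-- `f^⊥` is adjoint to multiplication by `f`. -/
theorem hall_perp (f g u : Lam) : hall (perp f g) u = hall g (f * u) := by
  classical
  have key : ∀ a b c : ℕ+ →₀ ℕ,
      hall (perp (MvPolynomial.monomial a 1) (MvPolynomial.monomial b 1))
        (MvPolynomial.monomial c 1) =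
      hall (MvPolynomial.monomial b 1)
        (MvPolynomial.monomial a (1 : ℂ) * MvPolynomial.monomial c 1) := by
    intro a b c
    rw [perp_monomial, hall_monomial, MvPolynomial.monomial_mul, MvPolynomial.coeff_monomial]
    split_ifs with h1 h2 h2
    · have hc : b - a = c := by rw [← h2]; simp
      have hs : (MvPolynomial.monomial (b - a) (zNumber b / zNumber (b - a)) : Lam) =
          (zNumber b / zNumber (b - a)) • MvPolynomial.monomial (b - a) 1 := by
        rw [MvPolynomial.smul_monomial, smul_eq_mul, mul_one]
      rw [hs, map_smul, LinearMap.smul_apply, hall_monomial, MvPolynomial.coeff_monomial,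
        if_pos hc.symm]
      rw [smul_eq_mul, mul_one, div_mul_cancel₀ _ (zNumber_ne_zero _)]
      ring
    · have hc : ¬ c = b - a := by
        rintro rfl
        exact h2 (add_tsub_cancel_of_le h1)
      have hs : (MvPolynomial.monomial (b - a) (zNumber b / zNumber (b - a)) : Lam) =
          (zNumber b / zNumber (b - a)) • MvPolynomial.monomial (b - a) 1 := by
        rw [MvPolynomial.smul_monomial, smul_eq_mul, mul_one]
      rw [hs, map_smul, LinearMap.smul_apply, hall_monomial, MvPolynomial.coeff_monomial,
        if_neg hc]
      simp
    · exact absurd (h2 ▸ le_self_add) h1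
    · simp
  induction f using MvPolynomial.induction_on' with
  | add p q hp hq => rw [map_add, LinearMap.add_apply, map_add, LinearMap.add_apply, hp, hq,
      add_mul, map_add]
  | monomial a r =>
    induction g using MvPolynomial.induction_on' with
    | add p q hp hq => rw [map_add, map_add, LinearMap.add_apply, hp, hq, map_add,
        LinearMap.add_apply]
    | monomial b s =>
      induction u using MvPolynomial.induction_on' with
      | add p q hp hq => rw [map_add, hp, hq, mul_add, map_add]
      | monomial c t =>
        have e : ∀ (m : ℕ+ →₀ ℕ) (x : ℂ), (MvPolynomial.monomial m x : Lam) =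
            x • MvPolynomial.monomial m 1 := by
          intro m x
          rw [MvPolynomial.smul_monomial, smul_eq_mul, mul_one]
        rw [e a r, e b s, e c t]
        simp only [map_smul, LinearMap.smul_apply, smul_mul_assoc, mul_smul_comm, key,
          smul_eq_mul]
        ring

/-- The adjointness relation determines `f^⊥ · g`. -/
theorem perp_unique (f g v : Lam) (hv : ∀ u : Lam, hall v u = hall g (f * u)) : v = perp f g := by
  classical
  have hsym : ∀ (w : Lam) (m : ℕ+ →₀ ℕ),
      hall w (MvPolynomial.monomial m 1) = zNumber m * MvPolynomial.coeff m w := by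
    intro w m
    induction w using MvPolynomial.induction_on' with
    | add p q hp hq => rw [map_add, LinearMap.add_apply, hp, hq, MvPolynomial.coeff_add, mul_add]
    | monomial c t =>
      have e : (MvPolynomial.monomial c t : Lam) = t • MvPolynomial.monomial c 1 := by
        rw [MvPolynomial.smul_monomial, smul_eq_mul, mul_one]
      rw [e, map_smul, LinearMap.smul_apply, hall_monomial, MvPolynomial.coeff_smul,
        MvPolynomial.coeff_monomial, MvPolynomial.coeff_monomial]
      by_cases hcm : c = m
      · subst hcm; simp; ring
      · rw [if_neg hcm, if_neg (fun h => hcm h.symm)]; simp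
  ext m
  have h1 := hv (MvPolynomial.monomial m 1)
  rw [← hall_perp, hsym, hsym] at h1
  exact mul_left_cancel₀ (zNumber_ne_zero m) h1

/-- The ring homomorphism `κ_d : Λ → Λ` with
`κ_d(p_i) = d - (i choose 1) p_1 + (i choose 2) p_2 - ⋯ + (-1)^i (i choose i) p_i`
(the effect on `p_i` of the substitution `x_j ↦ 1 - x_j` for `1 ≤ j ≤ d`). -/
def kappa (d : ℕ) : Lam →ₐ[ℂ] Lam :=
  MvPolynomial.aeval fun i : ℕ+ =>
    (d : Lam) + ∑ m ∈ Finset.Icc 1 (i : ℕ), (-1) ^ m * ((i : ℕ).choose m : Lam) * psum m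

/-! ### Partitions, Schur functions, dual stable Grothendieck polynomials

A partition `λ` is a Young diagram; in zero-based indexing `λ.rowLen i` is `λ_{i+1}`,
`λ.colLen j` is the part `λ'_{j+1}` of the conjugate partition, and `λ.colLen 0`, `λ.rowLen 0`
are the numbers of parts of `λ` and of `λ'`. -/

/-- The rectangle with `r` rows and `c` columns. -/
def rectangle (r c : ℕ) : YoungDiagram where
  cells := Finset.range r ×ˢ Finset.range c
  isLowerSet := by
    rintro ⟨a, b⟩ ⟨a', b'⟩ ⟨h1, h2⟩ h
    simp only [Finset.coe_product, Finset.coe_range, Set.mem_prod, Set.mem_Iio] at h ⊢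
    exact ⟨lt_of_le_of_lt h1 h.1, lt_of_le_of_lt h2 h.2⟩

/-- The rectangle `R_d` with `d` rows and `n - d` columns (used for `d ≤ n`). -/
def rect (n d : ℕ) : YoungDiagram := rectangle d (n - d)

/-- The Schur function `s_λ = det (h_{λ_i + j - i})`. -/
def schur (lam : YoungDiagram) : Lam :=
  Matrix.det (Matrix.of fun i j : Fin (lam.colLen 0) =>
    completeInt ((lam.rowLen i : ℤ) + (j : ℤ) - (i : ℤ)))

/-- The dual stable Grothendieck polynomial
`g_λ = det (∑_{m ≥ 0} (-1)^m (1-i choose m) h_{λ_i + j - i - m})`, the indices `i, j` running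
from `1`. With zero-based indices, `1 - i` becomes `-i`; the terms with `m > λ_i + j` vanish. -/
def dualGroth (lam : YoungDiagram) : Lam :=
  Matrix.det (Matrix.of fun i j : Fin (lam.colLen 0) =>
    ∑ m ∈ Finset.range (lam.rowLen i + (j : ℕ) + 1),
      (((-1) ^ m * Ring.choose (-(i : ℤ)) m : ℤ) : Lam) *
        completeInt ((lam.rowLen i : ℤ) + (j : ℤ) - (i : ℤ) - (m : ℤ)))

/-! ### The ring `Λ_(n)` and the determinants -/

/-- The subring `Λ_(n) = ℂ[h_1, …, h_{n-1}]` of `Λ`. -/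
abbrev LamN (n : ℕ) : Subalgebra ℂ Lam :=
  Algebra.adjoin ℂ {f | ∃ k, 1 ≤ k ∧ k < n ∧ f = complete k}

/-- `h_k`, `0 ≤ k < n`, as an element of `Λ_(n)` (and the unused value `0` for `k ≥ n`). -/
def hN (n k : ℕ) : LamN n :=
  if hk : k < n then
    ⟨complete k, by
      rcases Nat.eq_zero_or_pos k with rfl | hpos
      · rw [complete]; exact one_mem _
      · exact Algebra.subset_adjoin ⟨k, hpos, hk, rfl⟩⟩
  else 0

/-- The power `ζ^k`, `k ∈ ℤ`, of `ζ = 1 + u`, as a power series in `u = ζ - 1`. Elements of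
`Λ_(n)[ζ]/((ζ-1)^n)` are represented by power series in `u`, of which only the coefficients of
`1, u, …, u^{n-1}` are ever used. -/
def zetaPow (n : ℕ) (k : ℤ) : PowerSeries (LamN n) := PowerSeries.binomialSeries (LamN n) k

/-- The generic element `φ = ∑_{k < n} (-1)^k h_k (ζ-1)^k`. -/
def phi (n : ℕ) : PowerSeries (LamN n) := PowerSeries.mk fun k => (-1) ^ k * hN n k

/-- The determinant `|c(f_0), …, c(f_{n-1})|`, where `c(f)` is the column of coordinates of `f` in
the basis `1, ζ-1, …, (ζ-1)^{n-1}`; it satisfies `|c(1), c(ζ), …, c(ζ^{n-1})| = 1`. -/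
def coordDet (n : ℕ) (f : Fin n → PowerSeries (LamN n)) : LamN n :=
  Matrix.det (Matrix.of fun i j : Fin n => PowerSeries.coeff (i : ℕ) (f j))

/-- `D(θ_1, …, θ_d) = |c(ζ^{-θ_1} φ), …, c(ζ^{-θ_d} φ), c(1), c(ζ), …, c(ζ^{n-d-1})|`. -/
def bigD (n d : ℕ) (θ : Fin d → ℤ) : LamN n :=
  coordDet n fun j =>
    if hj : (j : ℕ) < d then zetaPow n (-θ ⟨j, hj⟩) * phi n
    else zetaPow n ((j : ℤ) - (d : ℤ))

/-- `τ_0 = 1` and `τ_i = |b_0, …, b_{i-1}, a_{i-1}, …, a_{n-2}|` for `1 ≤ i ≤ n`, where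
`a_j = c(ζ^j)` and `b_j = c(ζ^j φ)`. -/
def tau (n i : ℕ) : LamN n :=
  if i = 0 then 1
  else coordDet n fun j =>
    if (j : ℕ) < i then zetaPow n (j : ℤ) * phi n else zetaPow n ((j : ℤ) - 1)

/-- `σ_i = |b_0, …, b_{i-1}, a_i, …, a_{n-1}|` for `0 ≤ i ≤ n`, where `a_j = c(ζ^j)` and
`b_j = c(ζ^j φ)`. -/
def sigma (n i : ℕ) : LamN n :=
  coordDet n fun j =>
    if (j : ℕ) < i then zetaPow n (j : ℤ) * phi n else zetaPow n (j : ℤ)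

/-- The localization `Λ_(n)[τ_i⁻¹, σ_i⁻¹ (1 ≤ i ≤ n-1)]`. -/
abbrev KLoc (n : ℕ) : Type :=
  Localization (Submonoid.closure {f : LamN n | ∃ i, 1 ≤ i ∧ i < n ∧ (f = tau n i ∨ f = sigma n i)})

/-- The canonical map `Λ_(n) → Λ_(n)[τ_i⁻¹, σ_i⁻¹]`. -/
def toKLoc (n : ℕ) : LamN n →+* KLoc n := algebraMap (LamN n) (KLoc n)

/-! ### The relativistic Toda side -/

/-- The polynomial ring `ℂ[z_1, …, z_n, Q_1, …, Q_{n-1}]`. -/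
abbrev Poly (n : ℕ) : Type := MvPolynomial (Fin n ⊕ Fin (n - 1)) ℂ

/-- The variable `z_j`, `1 ≤ j ≤ n` (and the unused value `0` for other `j`). -/
def zvar (n j : ℕ) : Poly n :=
  if hj : 1 ≤ j ∧ j ≤ n then MvPolynomial.X (Sum.inl ⟨j - 1, by omega⟩) else 0

/-- The variable `Q_j`, `1 ≤ j ≤ n - 1`, with the convention `Q_n = 0`. -/
def Qvar (n j : ℕ) : Poly n :=
  if hj : 1 ≤ j ∧ j < n then MvPolynomial.X (Sum.inr ⟨j - 1, by omega⟩) else 0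

/-- The polynomial
`F^{(m)}_k = ∑_{I ⊆ {1,…,m}, #I = k} ∏_{j ∈ I} z_j ∏_{j ∈ I, j+1 ∉ I} (1 - Q_j)`
for `1 ≤ m ≤ n` and an integer `k`; so `F^{(m)}_0 = 1`, and `F^{(m)}_k = 0` for `k < 0` or
`k > m`. -/
def Fpoly (n m : ℕ) (k : ℤ) : Poly n :=
  ∑ I ∈ (Finset.Icc 1 m).powerset with (I.card : ℤ) = k,
    (∏ j ∈ I, zvar n j) * ∏ j ∈ I with j + 1 ∉ I, (1 - Qvar n j)

/-- The ideal of the unipotent isospectral variety `Z_uni`, generated by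
`F_i - (n choose i)`, `1 ≤ i ≤ n`, where `F_i = F^{(n)}_i`. -/
def uniIdeal (n : ℕ) : Ideal (Poly n) :=
  Ideal.span {f | ∃ i : ℕ, 1 ≤ i ∧ i ≤ n ∧ f = Fpoly n n (i : ℤ) - ((n.choose i : ℕ) : Poly n)}

/-- The coordinate ring `ℂ[Z_uni]`. -/
abbrev QK (n : ℕ) : Type := Poly n ⧸ uniIdeal n

/-- The coordinate ring `ℂ[Z_uni°]`, the localization of `ℂ[Z_uni]` by `Q_1, …, Q_{n-1}`. -/
abbrev QKLoc (n : ℕ) : Type :=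
  Localization.Away (Ideal.Quotient.mk (uniIdeal n) (∏ j ∈ Finset.Ico 1 n, Qvar n j))

/-- The class in `ℂ[Z_uni°]` of a polynomial in `z` and `Q`. -/
def toQKLoc (n : ℕ) : Poly n →+* QKLoc n :=
  (algebraMap (QK n) (QKLoc n)).comp (Ideal.Quotient.mk (uniIdeal n))

/-- The quantized Schur determinant
`S^Q_{λ,d} = det (F^{(d+j-1)}_{λ'_i - i + j})`, `1 ≤ i, j ≤ ℓ(λ')`. -/
def quantumSchur (n d : ℕ) (lam : YoungDiagram) : Poly n :=
  Matrix.det (Matrix.of fun i j : Fin (lam.rowLen 0) =>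
    Fpoly n (d + (j : ℕ)) ((lam.colLen i : ℤ) - (i : ℤ) + (j : ℤ)))

/-- The sequence `i_a = λ_{d+1-a} + a`, `1 ≤ a ≤ d`; the zero-based index `a : Fin d` stands for
`a + 1`. -/
def indexSeq (d : ℕ) (lam : YoungDiagram) (a : Fin d) : ℤ :=
  (lam.rowLen (d - 1 - (a : ℕ)) : ℤ) + ((a : ℤ) + 1)

end KPeterson

end

open KPeterson

open scoped BigOperators

noncomputable section

namespace KPeterson

/-! Put ζ = 1 + X; every coordinate determinant is taken modulo X^n.

For sequences z and Q let P_m = Σ_k (-1)^k F^{(m)}_k ζ^{m-k}, and let P̃_m be its value at Q_m = 0.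
Both are monic of degree m and satisfy a joint recursion (`todaPair`). When z and Q are the stated
quotients of τ and σ, Cramer's rule shows that P̃_m φ (m ≤ n) and P_m ζφ (m < n) lie in the span of
ζ^m, …, ζ^{n-1} modulo X^n: the value of z_{m+1} removes the coefficient of ζ^m, and that of Q_{m+1}
removes the coefficient of ζ^{n-1} just before a multiplication by ζ (`todaPair_expansion`). For m =
n the span is zero, P_n = P̃_n because Q_n = 0, and φ is a unit; so X^n divides the monic polynomial
P_n, which is therefore (ζ - 1)^n. These are the relations F_i = (n choose i), and Φ is well
defined.

For the quotient formula, consider the n columns ζ^{μ_j}·ζφ, with μ_1 < … < μ_d the numbers λ_d,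
λ_{d-1} + 1, …, λ_1 + d - 1, followed by P_j ζφ for d ≤ j < n. In the basis ζ^r·ζφ their determinant
is the quantized Schur determinant; expanding only the P_j ζφ in powers of ζ gives D(…)/τ_d
(`det_todaF_mul_tauDet`). Also τ_d = D(d-1, …, 0).

For the formula with adjoints, p_k^⊥ = k ∂/∂p_k multiplies Σ (-1)^i h_i X^i by (-X)^k = (1 - ζ)^k.
On |ζ^{e_1+1-d} φ, …, ζ^{e_d+1-d} φ, 1, …, ζ^{c-1}|, encoded by the monomial x^e, it therefore acts
as multiplication by Σ_a (1 - x_a)^k. The substitution κ_d turns 1 - x into x, so κ_d(f)^⊥ becomes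
multiplication by f(x_1, …, x_d) (`perp_kappa_alternantMap`). The bialternant formula then carries
the determinant of ∅ to that of λ (`perp_kappa_schur`), and the determinant of ∅ is g_{R_d}
(`dualGroth_rectangle`). -/

open scoped PowerSeries

/-! ### Coordinate determinants of power series modulo X^n. -/

section Coord

variable {R S : Type*} [CommRing R] [CommRing S]

/-- The determinant of the coefficients of `1, X, …, X^{n-1}`, as an alternating form on power
series. -/
def coordForm (R : Type*) [CommRing R] (n : ℕ) : R⟦X⟧ [⋀^Fin n]→ₗ[R] R :=
  (Matrix.detRowAlternating (R := R) (n := Fin n)).compLinearMap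
    (LinearMap.pi fun i : Fin n => PowerSeries.coeff (i : ℕ))

theorem coordForm_apply (n : ℕ) (f : Fin n → R⟦X⟧) :
    coordForm R n f = Matrix.det (Matrix.of fun i j : Fin n => PowerSeries.coeff (i : ℕ) (f j)) := by
  rw [← Matrix.det_transpose]
  rfl

theorem coordForm_congr {n : ℕ} {f g : Fin n → R⟦X⟧} (h : ∀ j, PowerSeries.X ^ n ∣ f j - g j) :
    coordForm R n f = coordForm R n g := by
  rw [coordForm_apply, coordForm_apply]
  congr 1
  ext i j
  exact sub_eq_zero.mp ((map_sub _ _ _).symm.trans (PowerSeries.X_pow_dvd_iff.mp (h j) i i.2))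

theorem map_coordForm (φ : R →+* S) (n : ℕ) (f : Fin n → R⟦X⟧) :
    φ (coordForm R n f) = coordForm S n fun j => PowerSeries.map φ (f j) := by
  rw [coordForm_apply, coordForm_apply, RingHom.map_det]
  rfl

theorem coordForm_sum_smul {n : ℕ} (T : Matrix (Fin n) (Fin n) R) (g : Fin n → R⟦X⟧) :
    coordForm R n (fun j => ∑ k, T k j • g k) = T.det * coordForm R n g := by
  rw [coordForm_apply, coordForm_apply, mul_comm, ← Matrix.det_mul]
  congr 1
  ext i j
  simp [Matrix.mul_apply, mul_comm]

/-- Multiplication by `g` acts on coordinates through a lower triangular Toeplitz matrix with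
diagonal 1. This is what allows all columns to be multiplied by a power of ζ. -/
theorem coordForm_mul_left {n : ℕ} (g : R⟦X⟧) (hg : PowerSeries.constantCoeff g = 1)
    (f : Fin n → R⟦X⟧) : coordForm R n (fun j => g * f j) = coordForm R n f := by
  have hT : (Matrix.of fun i k : Fin n =>
      if k ≤ i then PowerSeries.coeff ((i : ℕ) - k) g else 0).det = 1 := by
    rw [Matrix.det_of_isLowerTriangular]
    · simp [hg]
    · intro i j hij
      have : i < j := hij
      simp [not_le.mpr this]
  rw [coordForm_apply, coordForm_apply,
    ← one_mul (Matrix.det (Matrix.of fun i j : Fin n => PowerSeries.coeff (i : ℕ) (f j))), ← hT,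
    ← Matrix.det_mul]
  congr 1
  ext i j
  rw [Matrix.mul_apply]
  simp only [Matrix.of_apply, PowerSeries.coeff_mul]
  rw [← Finset.Nat.sum_antidiagonal_swap, Finset.Nat.sum_antidiagonal_eq_sum_range_succ_mk]
  refine Eq.trans ?_ (Finset.sum_range fun k => (if k ≤ (i : ℕ) then
    PowerSeries.coeff ((i : ℕ) - k) g else 0) * PowerSeries.coeff k (f j))
  refine Finset.sum_subset_zero_on_sdiff (Finset.range_subset_range.mpr i.2) ?_ ?_
  · intro k hk
    have : ¬ k ≤ (i : ℕ) := fun h => (Finset.mem_sdiff.mp hk).2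
      (Finset.mem_range.mpr (Nat.lt_succ_of_le h))
    rw [if_neg this, zero_mul]
  · intro k hk
    rw [if_pos (Nat.lt_succ_iff.mp (Finset.mem_range.mp hk))]
    rfl

theorem coordForm_one_add_X_pow (n : ℕ) :
    coordForm R n (fun j => (1 + PowerSeries.X) ^ (j : ℕ)) = 1 := by
  have h (i j : ℕ) : PowerSeries.coeff i ((1 + PowerSeries.X : R⟦X⟧) ^ j) = (j.choose i : R) := by
    rw [← PowerSeries.binomialSeries_nat (R := ℤ), PowerSeries.binomialSeries_coeff,
      Ring.choose_natCast]
    simp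
  rw [coordForm_apply, Matrix.det_of_isUpperTriangular]
  · simp [h]
  · intro i j hij
    have : j < i := hij
    simp [h, Nat.choose_eq_zero_of_lt (Fin.lt_def.mp this)]

theorem coordDet_eq (n : ℕ) (f : Fin n → PowerSeries (LamN n)) :
    coordDet n f = coordForm (LamN n) n f :=
  (coordForm_apply n f).symm

end Coord

section Alternating

variable {R M N ι : Type*} [CommRing R] [AddCommGroup M] [AddCommGroup N] [Module R M] [Module R N]
  [DecidableEq ι]

theorem alternating_update_add_sum (g : M [⋀^ι]→ₗ[R] N) (f : ι → M) (j : ι) (v : M)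
    {κ : Type*} (s : Finset κ) (c : κ → R) (w : κ → M) (hw : ∀ k ∈ s, ∃ i, i ≠ j ∧ w k = f i) :
    g (Function.update f j (v + ∑ k ∈ s, c k • w k)) = g (Function.update f j v) := by
  rw [AlternatingMap.map_update_add, AlternatingMap.map_update_sum, Finset.sum_eq_zero, add_zero]
  intro k hk
  obtain ⟨i, hij, hi⟩ := hw k hk
  rw [AlternatingMap.map_update_smul, hi, AlternatingMap.map_update_self _ _ hij.symm, smul_zero]

end Alternating

/-! ### Cramer's rule for the mixed determinants. -/

section Mixed

variable {R : Type*} [CommRing R]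

/-- The determinant `|b_0, …, b_{m-1}, a_m, …, a_{n-1}|`. -/
def mixedDet (n : ℕ) (b a : ℕ → R⟦X⟧) (m : ℕ) : R :=
  coordForm R n fun j => if (j : ℕ) < m then b j else a j

variable {n m : ℕ} {b a : ℕ → R⟦X⟧} {v : R⟦X⟧} {c α : ℕ → R}

theorem coordForm_update_left (f : Fin n → R⟦X⟧) (j : Fin n) (hf : ∀ i : Fin n, (i : ℕ) < m → f i = b i)
    (hj : m ≤ j) (hv : v = b m + ∑ i ∈ Finset.range m, c i • b i) :
    coordForm R n (Function.update f j v) = coordForm R n (Function.update f j (b m)) := by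
  rw [hv]
  refine alternating_update_add_sum _ _ _ _ _ _ _ fun i hi => ?_
  have hi := Finset.mem_range.mp hi
  exact ⟨⟨i, by omega⟩, fun h => by rw [← h] at hj; exact absurd hi (not_lt.mpr hj),
    (hf ⟨i, by omega⟩ hi).symm⟩

theorem coordForm_update_right (f : Fin n → R⟦X⟧) (j : Fin n)
    (hf : ∀ i : Fin n, m ≤ i → i ≠ j → f i = a i)
    (hj : m ≤ j) (hv : PowerSeries.X ^ n ∣ v - ∑ i ∈ Finset.Ico m n, α i • a i) :
    coordForm R n (Function.update f j v) = α j * coordForm R n (Function.update f j (a j)) := by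
  have h1 : coordForm R n (Function.update f j v) =
      coordForm R n (Function.update f j (α j • a j + ∑ i ∈ (Finset.Ico m n).erase j, α i • a i)) := by
    rw [Finset.add_sum_erase _ (fun i => α i • a i) (Finset.mem_Ico.mpr ⟨hj, j.2⟩)]
    refine coordForm_congr fun i => ?_
    by_cases h : i = j
    · subst h; simpa using hv
    · simp [h]
  rw [h1, alternating_update_add_sum, AlternatingMap.map_update_smul, smul_eq_mul]
  intro i hi
  obtain ⟨hij, hi⟩ := Finset.mem_erase.mp hi
  have hi := Finset.mem_Ico.mp hi
  have hne : (⟨i, hi.2⟩ : Fin n) ≠ j := fun h => hij (by rw [← h])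
  exact ⟨⟨i, hi.2⟩, hne, (hf ⟨i, hi.2⟩ hi.1 hne).symm⟩

/-- Put `v` in place of column `m`. Modulo the earlier columns it is `b m`; modulo the later ones it
is `α m • a m`. -/
theorem mixedDet_succ (hm : m < n) (hv : v = b m + ∑ i ∈ Finset.range m, c i • b i)
    (hva : PowerSeries.X ^ n ∣ v - ∑ i ∈ Finset.Ico m n, α i • a i) :
    α m * mixedDet n b a m = mixedDet n b a (m + 1) := by
  have h := coordForm_update_left (n := n) (fun j => if (j : ℕ) < m then b j else a j) ⟨m, hm⟩
    (fun i hi => if_pos hi) le_rfl hv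
  rw [coordForm_update_right (m := m) _ ⟨m, hm⟩ (fun i hi _ => if_neg (not_lt.mpr hi)) le_rfl
    hva] at h
  have e1 : Function.update (fun j : Fin n => if (j : ℕ) < m then b j else a j) ⟨m, hm⟩ (a m) =
      fun j : Fin n => if (j : ℕ) < m then b j else a j := by
    ext1 j
    by_cases hj : j = ⟨m, hm⟩
    · subst hj; simp
    · simp [hj]
  have e2 : Function.update (fun j : Fin n => if (j : ℕ) < m then b j else a j) ⟨m, hm⟩ (b m) =
      fun j : Fin n => if (j : ℕ) < m + 1 then b j else a j := by
    ext1 j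
    by_cases hj : j = ⟨m, hm⟩
    · subst hj; simp
    · have : (j : ℕ) ≠ m := fun h => hj (Fin.ext h)
      simp only [Function.update_of_ne hj]
      congr 1
      exact propext (by omega)
  rw [e1, e2] at h
  exact h

/-- The same comparison with `v` in the last column. A cycle of length `n - m` then brings `b m`
from the last place to place `m`, which gives the sign. -/
theorem mixedDet_top (hm : m < n) (hv : v = b m + ∑ i ∈ Finset.range m, c i • b i)
    (hva : PowerSeries.X ^ n ∣ v - ∑ i ∈ Finset.Ico m n, α i • a i) :
    α (n - 1) * mixedDet n b a m = (-1) ^ (n - 1 - m) *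
      coordForm R n fun j => if (j : ℕ) < m + 1 then b j else a ((j : ℕ) - 1) := by
  obtain ⟨N, rfl⟩ : ∃ N, n = N + 1 := ⟨n - 1, by omega⟩
  have h := coordForm_update_left (fun j : Fin (N + 1) => if (j : ℕ) < m then b j else a j)
    (Fin.last N) (fun i hi => if_pos hi) (by simp; omega) hv
  rw [coordForm_update_right (m := m) _ (Fin.last N) (fun i hi _ => if_neg (not_lt.mpr hi))
    (by simp; omega) hva] at h
  have hs : ((Equiv.Perm.sign (Fin.cycleIcc ⟨m, hm⟩ (Fin.last N)) : ℤˣ) : ℤ) =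
      (-1) ^ (N - m) := by
    rw [Fin.sign_cycleIcc_of_le (Fin.le_last _)]
    simp
  have e1 : Function.update (fun j : Fin (N + 1) => if (j : ℕ) < m then b j else a j)
      (Fin.last N) (a N) = fun j : Fin (N + 1) => if (j : ℕ) < m then b j else a j := by
    ext1 j
    by_cases hj : j = Fin.last N
    · subst hj
      have : ¬ N < m := by omega
      simp [this]
    · simp [hj]
  have e2 : Function.update (fun j : Fin (N + 1) => if (j : ℕ) < m then b j else a j)
      (Fin.last N) (b m) =
      (fun j : Fin (N + 1) => if (j : ℕ) < m + 1 then b j else a ((j : ℕ) - 1)) ∘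
        Fin.cycleIcc ⟨m, hm⟩ (Fin.last N) := by
    ext1 j
    by_cases hj : j = Fin.last N
    · subst hj
      simp [Fin.cycleIcc_of_last (Fin.le_last _)]
    · rw [Function.update_of_ne hj, Function.comp_apply]
      have hjN : (j : ℕ) < N := by
        have := j.2
        have : (j : ℕ) ≠ N := fun h => hj (Fin.ext h)
        omega
      by_cases hjm : (j : ℕ) < m
      · rw [Fin.cycleIcc_of_lt (Fin.lt_def.mpr hjm)]
        simp [hjm, show (j : ℕ) < m + 1 by omega]
      · rw [Fin.cycleIcc_of_ge_of_lt (Fin.le_def.mpr (not_lt.mp hjm)) (Fin.lt_def.mpr hjN)]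
        have : ((j + 1 : Fin (N + 1)) : ℕ) = j + 1 := Fin.val_add_one_of_lt (Fin.lt_def.mpr hjN)
        simp [hjm, this]
  rw [e2, AlternatingMap.map_perm, Fin.val_last, e1] at h
  simp only [Nat.add_sub_cancel]
  rw [mixedDet, h, Units.smul_def, hs]
  simp

end Mixed

/-! ### The polynomials F^{(m)}_k and their recursion. -/

section Toda

variable {R : Type*} [CommRing R]

open Polynomial in
/-- The polynomials `∑_k (-1)^k F^{(m)}_k X^{m-k}` and `∑_k (-1)^k F̃^{(m)}_k X^{m-k}`, where `F̃^{(m)}_k`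
is `F^{(m)}_k` at `Q_m = 0`. -/
def todaPair (z Q : ℕ → R) : ℕ → R[X] × R[X]
  | 0 => (1, 1)
  | m + 1 =>
    (X * (todaPair z Q m).1 - C (z (m + 1)) * (todaPair z Q m).2 +
      C (Q (m + 1) * z (m + 1)) * (todaPair z Q m).2,
     X * (todaPair z Q m).1 - C (z (m + 1)) * (todaPair z Q m).2)

/-- The function `F^{(m)}_k` of two sequences `z` and `Q` in a commutative ring. -/
def todaF (z Q : ℕ → R) (m : ℕ) (k : ℤ) : R :=
  ∑ I ∈ (Finset.Icc 1 m).powerset with (I.card : ℤ) = k,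
    (∏ j ∈ I, z j) * ∏ j ∈ I with j + 1 ∉ I, (1 - Q j)

section Recursion

open Polynomial

theorem todaPair_natDegree_le (z Q : ℕ → R) (m : ℕ) :
    (todaPair z Q m).1.natDegree ≤ m ∧ (todaPair z Q m).2.natDegree ≤ m := by
  induction m with
  | zero => simp [todaPair]
  | succ m ih =>
    have h2 : (X * (todaPair z Q m).1 - C (z (m + 1)) * (todaPair z Q m).2).natDegree ≤ m + 1 := by
      refine (natDegree_sub_le _ _).trans (max_le ?_ ?_)
      · refine natDegree_mul_le.trans ?_
        have := natDegree_X_le (R := R)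
        omega
      · exact (natDegree_C_mul_le _ _).trans (by omega)
    refine ⟨(natDegree_add_le _ _).trans (max_le h2 ?_), h2⟩
    exact (natDegree_C_mul_le _ _).trans (by omega)

theorem todaPair_coeff_self (z Q : ℕ → R) (m : ℕ) :
    (todaPair z Q m).1.coeff m = 1 ∧ (todaPair z Q m).2.coeff m = 1 := by
  induction m with
  | zero => simp [todaPair]
  | succ m ih =>
    have h := coeff_eq_zero_of_natDegree_lt
      (Nat.lt_succ_of_le (todaPair_natDegree_le z Q m).2)
    have h2 : (X * (todaPair z Q m).1 - C (z (m + 1)) * (todaPair z Q m).2).coeff (m + 1) = 1 := by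
      rw [coeff_sub, coeff_X_mul, coeff_C_mul, ih.1]
      simp only [Nat.succ_eq_add_one] at h
      rw [h]
      simp
    refine ⟨?_, h2⟩
    simp only [todaPair]
    simp only [Nat.succ_eq_add_one] at h
    rw [coeff_add, h2, coeff_C_mul, h]
    simp

/-- The subsets of {1, …, m+1} are split according to whether they contain m+1. If they do, an
element m is followed by m+1 and loses its factor 1 - Q_m; this is why the specialization at Q_m = 0
has to be carried along in the recursion. -/
theorem todaPair_eq_sum (z Q : ℕ → R) (m : ℕ) :
    (todaPair z Q m).1 = ∑ I ∈ (Finset.Icc 1 m).powerset,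
        C ((-1) ^ I.card * ((∏ j ∈ I, z j) * ∏ j ∈ I with j + 1 ∉ I, (1 - Q j))) *
          X ^ (m - I.card) ∧
      (todaPair z Q m).2 = ∑ I ∈ (Finset.Icc 1 m).powerset,
        C ((-1) ^ I.card * ((∏ j ∈ I, z j) * ∏ j ∈ I with j + 1 ∉ I ∧ j ≠ m, (1 - Q j))) *
          X ^ (m - I.card) := by
  induction m with
  | zero => simp [todaPair]
  | succ m ih =>
    have hIcc : Finset.Icc 1 (m + 1) = insert (m + 1) (Finset.Icc 1 m) := by
      ext x; simp only [Finset.mem_Icc, Finset.mem_insert]; omega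
    have hnot : m + 1 ∉ Finset.Icc 1 m := by simp
    have hcard : ∀ I ∈ (Finset.Icc 1 m).powerset, I.card ≤ m := fun I hI => by
      simpa using Finset.card_le_card (Finset.mem_powerset.mp hI)
    have hmem : ∀ I ∈ (Finset.Icc 1 m).powerset, ∀ j ∈ I, j ≤ m := fun I hI j hj =>
      (Finset.mem_Icc.mp (Finset.mem_powerset.mp hI hj)).2
    have hni : ∀ I ∈ (Finset.Icc 1 m).powerset, m + 1 ∉ I := fun I hI hj => by
      have := hmem I hI _ hj; omega
    have key : X * (todaPair z Q m).1 = ∑ I ∈ (Finset.Icc 1 m).powerset,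
        C ((-1) ^ I.card * ((∏ j ∈ I, z j) * ∏ j ∈ I with j + 1 ∉ I, (1 - Q j))) *
          X ^ (m + 1 - I.card) := by
      rw [ih.1, Finset.mul_sum]
      refine Finset.sum_congr rfl fun I hI => ?_
      rw [Nat.succ_sub (hcard I hI), pow_succ]
      ring
    have hfilt : ∀ I ∈ (Finset.Icc 1 m).powerset,
        (insert (m + 1) I).filter (fun j => j + 1 ∉ insert (m + 1) I) =
          insert (m + 1) (I.filter fun j => j + 1 ∉ I ∧ j ≠ m) := by
      intro I hI
      ext j
      have h1 := hmem I hI (j + 1)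
      have h2 := hmem I hI j
      simp only [Finset.mem_filter, Finset.mem_insert]
      constructor
      · rintro ⟨rfl | h, h'⟩
        · exact Or.inl rfl
        · refine Or.inr ⟨h, ?_, ?_⟩
          · exact fun h'' => h' (Or.inr h'')
          · rintro rfl; exact h' (Or.inl rfl)
      · rintro (rfl | ⟨h, h', h''⟩)
        · refine ⟨Or.inl rfl, ?_⟩
          rintro (h | h)
          · omega
          · have := h1 h; omega
        · refine ⟨Or.inr h, ?_⟩
          rintro (h3 | h3)
          · omega
          · exact h' h3
    have hfilt2 : ∀ I ∈ (Finset.Icc 1 m).powerset,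
        (insert (m + 1) I).filter (fun j => j + 1 ∉ insert (m + 1) I ∧ j ≠ m + 1) =
          I.filter fun j => j + 1 ∉ I ∧ j ≠ m := by
      intro I hI
      rw [← Finset.filter_filter, hfilt I hI]
      ext j
      have h2 := hmem I hI j
      simp only [Finset.mem_filter, Finset.mem_insert]
      constructor
      · rintro ⟨rfl | h, h'⟩
        · exact absurd rfl h'
        · exact h
      · intro h
        refine ⟨Or.inr h, ?_⟩
        have := h2 h.1; omega
    have hfilt3 : ∀ I ∈ (Finset.Icc 1 m).powerset,
        I.filter (fun j => j + 1 ∉ I ∧ j ≠ m + 1) = I.filter fun j => j + 1 ∉ I := by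
      intro I hI
      refine Finset.filter_congr fun j hj => ?_
      have := hmem I hI j hj
      simp; omega
    have hnf : ∀ I ∈ (Finset.Icc 1 m).powerset, m + 1 ∉ I.filter fun j => j + 1 ∉ I ∧ j ≠ m :=
      fun I hI h => hni I hI (Finset.mem_of_mem_filter _ h)
    have h2 : X * (todaPair z Q m).1 - C (z (m + 1)) * (todaPair z Q m).2 =
        ∑ I ∈ (Finset.Icc 1 (m + 1)).powerset,
        C ((-1) ^ I.card * ((∏ j ∈ I, z j) * ∏ j ∈ I with j + 1 ∉ I ∧ j ≠ m + 1, (1 - Q j))) *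
          X ^ (m + 1 - I.card) := by
      rw [hIcc, Finset.sum_powerset_insert hnot, key, ih.2, Finset.mul_sum, sub_eq_add_neg,
        ← Finset.sum_neg_distrib]
      congr 1
      · refine Finset.sum_congr rfl fun I hI => ?_
        rw [hfilt3 I hI]
      · refine Finset.sum_congr rfl fun I hI => ?_
        rw [hfilt2 I hI, Finset.card_insert_of_notMem (hni I hI),
          Finset.prod_insert (hni I hI), Nat.succ_sub_succ]
        simp only [map_mul, map_pow, map_neg, map_one]
        ring
    refine ⟨?_, h2⟩
    simp only [todaPair]
    rw [hIcc, Finset.sum_powerset_insert hnot, key, ih.2, Finset.mul_sum, Finset.mul_sum,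
      sub_add, ← Finset.sum_sub_distrib, sub_eq_add_neg, ← Finset.sum_neg_distrib]
    congr 1
    refine Finset.sum_congr rfl fun I hI => ?_
    rw [hfilt I hI, Finset.card_insert_of_notMem (hni I hI),
      Finset.prod_insert (hni I hI), Finset.prod_insert (hnf I hI), Nat.succ_sub_succ]
    simp only [map_mul, map_pow, map_neg, map_one, map_sub]
    ring

theorem todaPair_coeff (z Q : ℕ → R) {m r : ℕ} (hr : r ≤ m) :
    (todaPair z Q m).1.coeff r = (-1) ^ (m - r) * todaF z Q m ((m : ℤ) - r) := by
  rw [(todaPair_eq_sum z Q m).1, finsetSum_coeff, todaF, Finset.mul_sum, Finset.sum_filter]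
  refine Finset.sum_congr rfl fun I hI => ?_
  have hc : I.card ≤ m := by simpa using Finset.card_le_card (Finset.mem_powerset.mp hI)
  rw [coeff_C_mul, coeff_X_pow]
  by_cases h : (I.card : ℤ) = (m : ℤ) - r
  · have : I.card = m - r := by omega
    rw [if_pos h, if_pos (by omega), mul_one, this]
  · rw [if_neg h, if_neg (by omega), mul_zero]

theorem todaF_eq_zero_of_neg (z Q : ℕ → R) (m : ℕ) {k : ℤ} (hk : k < 0) : todaF z Q m k = 0 := by
  rw [todaF, Finset.filter_false_of_mem, Finset.sum_empty]
  intro I _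
  omega

theorem todaF_zero (z Q : ℕ → R) (m : ℕ) : todaF z Q m 0 = 1 := by
  have := todaPair_coeff z Q (le_refl m)
  simpa [(todaPair_coeff_self z Q m).1] using this.symm

end Recursion

end Toda

/-! ### The quotients of τ and σ solve the unipotent relations. -/

section TodaSolution

variable {R : Type*} [CommRing R]

theorem _root_.PowerSeries.aeval_X_eq_coe (p : Polynomial R) :
    Polynomial.aeval (PowerSeries.X : R⟦X⟧) p = p := by
  rw [Polynomial.aeval_def, PowerSeries.algebraMap_eq]
  exact Polynomial.eval₂_C_X_eq_coe

-- Taylor re-expansion: the truncation is rewritten as a polynomial in ζ by substituting ζ - 1 for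
-- X.
open Polynomial in
theorem exists_dvd_sub_sum_pow (n : ℕ) (f : R⟦X⟧) :
    ∃ α : ℕ → R, (PowerSeries.X : R⟦X⟧) ^ n ∣
      f - ∑ j ∈ Finset.Ico 0 n, α j • (1 + PowerSeries.X) ^ j := by
  rcases Nat.eq_zero_or_pos n with rfl | hn
  · exact ⟨0, by simp⟩
  set g : R[X] := (PowerSeries.trunc n f).comp (X - C 1)
  have hg : g.natDegree < n := by
    refine lt_of_le_of_lt natDegree_comp_le ?_
    refine lt_of_le_of_lt (Nat.mul_le_mul_left _ (natDegree_X_sub_C_le 1)) ?_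
    rw [mul_one]
    have := PowerSeries.natDegree_trunc_lt f (n - 1)
    rwa [Nat.sub_add_cancel hn] at this
  refine ⟨g.coeff, ?_⟩
  have h1 : ∑ j ∈ Finset.Ico 0 n, g.coeff j • (1 + PowerSeries.X : R⟦X⟧) ^ j =
      (PowerSeries.trunc n f : R⟦X⟧) := by
    rw [← Finset.range_eq_Ico, ← aeval_eq_sum_range' hg, aeval_comp]
    simp only [map_sub, aeval_X, map_one, add_sub_cancel_left]
    exact PowerSeries.aeval_X_eq_coe _
  rw [h1, PowerSeries.X_pow_dvd_iff]
  intro m hm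
  rw [map_sub, Polynomial.coeff_coe, PowerSeries.coeff_trunc, if_pos hm, sub_self]

/-- The powers of `1 + X`, as power series. -/
abbrev zetaSeq (R : Type*) [CommRing R] (j : ℕ) : R⟦X⟧ := (1 + PowerSeries.X) ^ j

theorem aeval_todaPair (z Q : ℕ → R) (m : ℕ) (ψ : R⟦X⟧) :
    Polynomial.aeval (1 + PowerSeries.X : R⟦X⟧) (todaPair z Q m).1 * ψ =
        zetaSeq R m * ψ + ∑ i ∈ Finset.range m, (todaPair z Q m).1.coeff i • (zetaSeq R i * ψ) ∧
      Polynomial.aeval (1 + PowerSeries.X : R⟦X⟧) (todaPair z Q m).2 * ψ =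
        zetaSeq R m * ψ + ∑ i ∈ Finset.range m, (todaPair z Q m).2.coeff i • (zetaSeq R i * ψ) := by
  have h (p : Polynomial R) (h1 : p.natDegree ≤ m) (h2 : p.coeff m = 1) :
      Polynomial.aeval (1 + PowerSeries.X : R⟦X⟧) p * ψ =
        zetaSeq R m * ψ + ∑ i ∈ Finset.range m, p.coeff i • (zetaSeq R i * ψ) := by
    rw [Polynomial.aeval_eq_sum_range' (Nat.lt_succ_of_le h1), Finset.sum_range_succ, h2, one_smul,
      add_comm, add_mul, Finset.sum_mul]
    simp only [smul_mul_assoc]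
  exact ⟨h _ (todaPair_natDegree_le z Q m).1 (todaPair_coeff_self z Q m).1,
    h _ (todaPair_natDegree_le z Q m).2 (todaPair_coeff_self z Q m).2⟩

/-- The determinant `σ_m` of `φ`; and `τ_m` is this determinant for `ζ φ`. -/
abbrev sigmaDet (n : ℕ) (φ : R⟦X⟧) (m : ℕ) : R :=
  mixedDet n (fun j => zetaSeq R j * φ) (zetaSeq R) m

abbrev tauDet (n : ℕ) (φ : R⟦X⟧) (m : ℕ) : R := sigmaDet n ((1 + PowerSeries.X) * φ) m

/-- Multiplying every column of τ by ζ turns it into the σ-determinant of ζφ, so that one Cramer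
argument serves both families. -/
theorem tauDet_succ_eq (n : ℕ) (φ : R⟦X⟧) (m : ℕ) :
    tauDet n φ (m + 1) = coordForm R n fun j : Fin n =>
      if (j : ℕ) < m + 1 then zetaSeq R j * φ else zetaSeq R ((j : ℕ) - 1) := by
  rw [← coordForm_mul_left (1 + PowerSeries.X) (by simp)]
  refine congrArg _ (funext fun j => ?_)
  split_ifs with h
  · ring
  · rw [← pow_succ', Nat.sub_add_cancel (by omega)]

variable {n : ℕ} {φ : R⟦X⟧} {z Q : ℕ → R}

/-- Induction on m. By Cramer's rule the leading coefficients are α_m = τ_{m+1}/τ_m and β_m =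
σ_{m+1}/σ_m, and the coefficient of ζ^{n-1} in P̃_m φ is ±τ_{m+1}/σ_m. The prescribed z and Q are
exactly those that make the unwanted terms in the recursion cancel. -/
theorem todaPair_expansion (hn : 1 ≤ n)
    (hσ : ∀ m ≤ n, IsUnit (sigmaDet n φ m)) (hτ : ∀ m ≤ n, IsUnit (tauDet n φ m))
    (hz : ∀ m < n, z (m + 1) * (tauDet n φ m * sigmaDet n φ (m + 1)) =
      tauDet n φ (m + 1) * sigmaDet n φ m)
    (hQ : ∀ m, m + 1 < n → Q (m + 1) * tauDet n φ (m + 1) ^ 2 =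
      tauDet n φ m * tauDet n φ (m + 2)) (m : ℕ) (hm : m ≤ n) :
    (m < n → ∃ α : ℕ → R, PowerSeries.X ^ n ∣
      Polynomial.aeval (1 + PowerSeries.X : R⟦X⟧) (todaPair z Q m).1 * ((1 + PowerSeries.X) * φ) -
        ∑ j ∈ Finset.Ico m n, α j • zetaSeq R j) ∧
    ∃ β : ℕ → R, PowerSeries.X ^ n ∣
      Polynomial.aeval (1 + PowerSeries.X : R⟦X⟧) (todaPair z Q m).2 * φ -
        ∑ j ∈ Finset.Ico m n, β j • zetaSeq R j := by
  induction m with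
  | zero =>
    simp only [todaPair, map_one, one_mul]
    exact ⟨fun _ => exists_dvd_sub_sum_pow n _, exists_dvd_sub_sum_pow n _⟩
  | succ m ih =>
    obtain ⟨h1, β, hβ⟩ := ih (by omega)
    obtain ⟨α, hα⟩ := h1 hm
    have hα0 : α m * tauDet n φ m = tauDet n φ (m + 1) :=
      mixedDet_succ hm (aeval_todaPair z Q m _).1 hα
    have hβ0 : β m * sigmaDet n φ m = sigmaDet n φ (m + 1) :=
      mixedDet_succ hm (aeval_todaPair z Q m _).2 hβ
    have hβt : β (n - 1) * sigmaDet n φ m = (-1) ^ (n - 1 - m) * tauDet n φ (m + 1) :=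
      (mixedDet_top hm (aeval_todaPair z Q m _).2 hβ).trans (by rw [tauDet_succ_eq])
    -- z_{m+1} = α_m/β_m, so P̃_{m+1} φ = P_m ζφ - z_{m+1} P̃_m φ has no ζ^m term.
    have hlow : α m - z (m + 1) * β m = 0 := by
      have hu := (hτ m (by omega)).mul (hσ m (by omega))
      refine hu.mul_left_eq_zero.mp ?_
      linear_combination sigmaDet n φ m * hα0 - z (m + 1) * tauDet n φ m * hβ0 - hz m hm
    set β' : ℕ → R := fun j => α j - z (m + 1) * β j
    have hstep : PowerSeries.X ^ n ∣
        Polynomial.aeval (1 + PowerSeries.X : R⟦X⟧) (todaPair z Q (m + 1)).2 * φ -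
          ∑ j ∈ Finset.Ico m n, β' j • zetaSeq R j := by
      have := dvd_sub hα (hβ.mul_left (PowerSeries.C (z (m + 1))))
      convert this using 1
      simp only [todaPair, map_sub, map_mul, Polynomial.aeval_X, Polynomial.aeval_C, β', sub_smul,
        Finset.sum_sub_distrib, mul_smul, mul_sub, Finset.mul_sum, PowerSeries.smul_eq_C_mul,
        PowerSeries.algebraMap_apply, Algebra.algebraMap_self, RingHom.id_apply]
      ring
    have hβ' : PowerSeries.X ^ n ∣
        Polynomial.aeval (1 + PowerSeries.X : R⟦X⟧) (todaPair z Q (m + 1)).2 * φ -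
          ∑ j ∈ Finset.Ico (m + 1) n, β' j • zetaSeq R j := by
      rw [Finset.sum_eq_sum_Ico_succ_bot hm, show β' m = 0 from hlow, zero_smul, zero_add] at hstep
      exact hstep
    refine ⟨fun hm1 => ?_, β', hβ'⟩
    have hβ't : β' (n - 1) * sigmaDet n φ (m + 1) =
        (-1) ^ (n - 1 - (m + 1)) * tauDet n φ (m + 2) :=
      (mixedDet_top hm1 (aeval_todaPair z Q (m + 1) _).2 hβ').trans (by rw [tauDet_succ_eq])
    set γ : ℕ → R := fun j => β' j + Q (m + 1) * z (m + 1) * β j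
    have hγ : PowerSeries.X ^ n ∣
        Polynomial.aeval (1 + PowerSeries.X : R⟦X⟧) (todaPair z Q (m + 1)).1 * φ -
          ∑ j ∈ Finset.Ico m n, γ j • zetaSeq R j := by
      have := dvd_add hstep (hβ.mul_left (PowerSeries.C (Q (m + 1) * z (m + 1))))
      convert this using 1
      simp only [todaPair, map_sub, map_add, map_mul, Polynomial.aeval_X, Polynomial.aeval_C, γ,
        add_smul, Finset.sum_add_distrib, mul_smul, mul_sub, Finset.mul_sum, mul_assoc, PowerSeries.smul_eq_C_mul,
        PowerSeries.algebraMap_apply, Algebra.algebraMap_self, RingHom.id_apply]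
      ring
    -- The ζ^{n-1} coefficients of P̃_{m+1} φ and P̃_m φ are τ_{m+2}/σ_{m+1} and τ_{m+1}/σ_m up to
    -- opposite signs; Q_{m+1} z_{m+1} is their ratio.
    have htop : γ (n - 1) = 0 := by
      have hu := ((hτ (m + 1) (by omega)).mul (hσ m (by omega))).mul (hσ (m + 1) (by omega))
      refine hu.mul_left_eq_zero.mp ?_
      have he : (-1 : R) ^ (n - 1 - m) = - (-1) ^ (n - 1 - (m + 1)) := by
        rw [show n - 1 - m = n - 1 - (m + 1) + 1 by omega, pow_succ]
        ring
      rw [he] at hβt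
      simp only [γ]
      linear_combination tauDet n φ (m + 1) * sigmaDet n φ m * hβ't +
        Q (m + 1) * z (m + 1) * tauDet n φ (m + 1) * sigmaDet n φ (m + 1) * hβt
        - (-1) ^ (n - 1 - (m + 1)) * (z (m + 1) * sigmaDet n φ (m + 1) * hQ m hm1
          + tauDet n φ (m + 2) * hz m hm)
    -- With the top term gone, multiplication by ζ moves the span of ζ^m, …, ζ^{n-2} to that of
    -- ζ^{m+1}, …, ζ^{n-1}.
    refine ⟨fun j => γ (j - 1), ?_⟩
    have := hγ.mul_left (1 + PowerSeries.X)
    convert this using 1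
    have hs : Finset.Ico (m + 1) n = Finset.Ico (m + 1) (n - 1 + 1) := by
      rw [Nat.sub_add_cancel hn]
    have hs' : Finset.Ico m n = Finset.Ico m (n - 1 + 1) := by
      rw [Nat.sub_add_cancel hn]
    rw [hs', Finset.sum_Ico_succ_top (by omega), htop, zero_smul, add_zero, mul_sub, Finset.mul_sum,
      hs, ← Finset.sum_Ico_add' _ m (n - 1) 1]
    congr 1
    · ring
    · refine Finset.sum_congr rfl fun j _ => ?_
      simp only [Nat.add_sub_cancel]
      rw [mul_smul_comm, zetaSeq, pow_succ']

theorem todaPair_eq_X_sub_one_pow (hn : 1 ≤ n) (hφ : IsUnit φ)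
    (hσ : ∀ m ≤ n, IsUnit (sigmaDet n φ m)) (hτ : ∀ m ≤ n, IsUnit (tauDet n φ m))
    (hz : ∀ m < n, z (m + 1) * (tauDet n φ m * sigmaDet n φ (m + 1)) =
      tauDet n φ (m + 1) * sigmaDet n φ m)
    (hQ : ∀ m, m + 1 < n → Q (m + 1) * tauDet n φ (m + 1) ^ 2 =
      tauDet n φ m * tauDet n φ (m + 2)) (hQn : Q n = 0) :
    (todaPair z Q n).1 = (Polynomial.X - Polynomial.C 1) ^ n := by
  obtain ⟨-, β, hβ⟩ := todaPair_expansion hn hσ hτ hz hQ n le_rfl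
  have h12 : (todaPair z Q n).1 = (todaPair z Q n).2 := by
    obtain ⟨m, rfl⟩ : ∃ m, n = m + 1 := ⟨n - 1, by omega⟩
    simp [todaPair, hQn]
  rw [Finset.Ico_self, Finset.sum_empty, sub_zero, ← h12, hφ.dvd_mul_right] at hβ
  set p := (todaPair z Q n).1
  have hdeg : p.natDegree ≤ n := (todaPair_natDegree_le z Q n).1
  have hlead : p.coeff n = 1 := (todaPair_coeff_self z Q n).1
  -- In the variable ζ - 1 the polynomial is monic of degree n and divisible by X^n.
  have hcomp : p.comp (Polynomial.X + Polynomial.C 1) = Polynomial.X ^ n := by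
    have hq : (p.comp (Polynomial.X + Polynomial.C 1) : R⟦X⟧) =
        Polynomial.aeval (1 + PowerSeries.X : R⟦X⟧) p := by
      rw [← PowerSeries.aeval_X_eq_coe, Polynomial.aeval_comp]
      simp [add_comm]
    nontriviality R
    have hmon : p.Monic := Polynomial.monic_of_natDegree_le_of_coeff_eq_one n hdeg hlead
    have hpn : p.natDegree = n := le_antisymm hdeg
      (Polynomial.le_natDegree_of_ne_zero (by rw [hlead]; exact one_ne_zero))
    have hmon' : (p.comp (Polynomial.X + Polynomial.C 1)).Monic := hmon.comp_X_add_C 1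
    have hnd : (p.comp (Polynomial.X + Polynomial.C 1)).natDegree = n := by
      rw [Polynomial.natDegree_comp_eq_of_mul_ne_zero]
      · rw [Polynomial.natDegree_X_add_C, mul_one, hpn]
      · rw [hmon.leadingCoeff, Polynomial.leadingCoeff_X_add_C, one_pow, mul_one]
        exact one_ne_zero
    ext k
    rw [Polynomial.coeff_X_pow]
    rcases lt_trichotomy k n with h | h | h
    · rw [if_neg h.ne, ← Polynomial.coeff_coe, hq]
      exact PowerSeries.X_pow_dvd_iff.mp hβ k h
    · subst h
      rw [if_pos rfl]
      conv_lhs => rw [← hnd]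
      exact hmon'
    · rw [if_neg h.ne', Polynomial.coeff_eq_zero_of_natDegree_lt (by omega)]
  have := congrArg (fun q => q.comp (Polynomial.X - Polynomial.C 1)) hcomp
  simpa [Polynomial.comp_assoc] using this

theorem todaF_eq_choose (hn : 1 ≤ n) (hφ : IsUnit φ)
    (hσ : ∀ m ≤ n, IsUnit (sigmaDet n φ m)) (hτ : ∀ m ≤ n, IsUnit (tauDet n φ m))
    (hz : ∀ m < n, z (m + 1) * (tauDet n φ m * sigmaDet n φ (m + 1)) =
      tauDet n φ (m + 1) * sigmaDet n φ m)
    (hQ : ∀ m, m + 1 < n → Q (m + 1) * tauDet n φ (m + 1) ^ 2 =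
      tauDet n φ m * tauDet n φ (m + 2)) (hQn : Q n = 0) {i : ℕ} (hi : i ≤ n) :
    todaF z Q n i = n.choose i := by
  have h := todaPair_coeff z Q (Nat.sub_le n i)
  rw [todaPair_eq_X_sub_one_pow hn hφ hσ hτ hz hQ hQn, sub_eq_add_neg, ← map_neg,
    Polynomial.coeff_X_add_C_pow, Nat.sub_sub_self hi, Nat.choose_symm hi] at h
  have hu : IsUnit ((-1 : R) ^ i) := (isUnit_one.neg).pow i
  have := hu.mul_left_cancel h
  rw [this]
  congr 1
  omega

end TodaSolution

/-! ### The permutation attached to a partition and its sign. -/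

section Shuffle

variable {d c : ℕ} {lam : YoungDiagram}

/-- The sequence `λ_d + 0, λ_{d-1} + 1, …, λ_1 + d - 1` followed by its complement in
`{0, …, d + c - 1}`. -/
def mayaSeq (d : ℕ) (lam : YoungDiagram) (j : ℕ) : ℕ :=
  if j < d then lam.rowLen (d - 1 - j) + j else d - lam.colLen (j - d) + (j - d)

theorem mayaSeq_lt (hr : lam.rowLen 0 ≤ c) {j : ℕ} (hj : j < d + c) : mayaSeq d lam j < d + c := by
  have h1 := lam.rowLen_anti 0 (d - 1 - j) (Nat.zero_le _)
  rw [mayaSeq]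
  split_ifs with h <;> omega

/-- The sequence increases on each of its two blocks. An inversion between the blocks corresponds to
a cell of λ, in row `d - 1 - i` and column `j - d`. -/
theorem mayaSeq_lt_mayaSeq {i j : ℕ} (hij : i < j) (hc : lam.colLen 0 ≤ d) :
    mayaSeq d lam i < mayaSeq d lam j ↔ ¬ (i < d ∧ d ≤ j ∧ d - lam.colLen (j - d) ≤ i) := by
  have hcol (k : ℕ) : lam.colLen k ≤ d := (lam.colLen_anti 0 k (Nat.zero_le _)).trans hc
  rw [mayaSeq, mayaSeq]
  split_ifs with hi hj hj
  · have := lam.rowLen_anti (d - 1 - j) (d - 1 - i) (by omega)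
    constructor <;> intros <;> omega
  · have h1 : j - d < lam.rowLen (d - 1 - i) ↔ d - 1 - i < lam.colLen (j - d) := by
      rw [← YoungDiagram.mem_iff_lt_rowLen, YoungDiagram.mem_iff_lt_colLen]
    have h2 := hcol (j - d)
    have h3 : (j - d < lam.rowLen (d - 1 - i) ∧ d - 1 - i < lam.colLen (j - d)) ∨
      (¬ j - d < lam.rowLen (d - 1 - i) ∧ ¬ d - 1 - i < lam.colLen (j - d)) := by tauto
    constructor <;> intros <;> omega
  · omega
  · have := lam.colLen_anti (i - d) (j - d) (by omega)
    constructor <;> intros <;> omega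

theorem mayaSeq_inj (hc : lam.colLen 0 ≤ d) {i j : ℕ} (h : mayaSeq d lam i = mayaSeq d lam j) :
    i = j := by
  have key {i j : ℕ} (hij : i < j) : mayaSeq d lam i ≠ mayaSeq d lam j := by
    have hcol (k : ℕ) : lam.colLen k ≤ d := (lam.colLen_anti 0 k (Nat.zero_le _)).trans hc
    rw [mayaSeq, mayaSeq]
    split_ifs with hi hj hj
    · have := lam.rowLen_anti (d - 1 - j) (d - 1 - i) (by omega)
      omega
    · have h1 : j - d < lam.rowLen (d - 1 - i) ↔ d - 1 - i < lam.colLen (j - d) := by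
        rw [← YoungDiagram.mem_iff_lt_rowLen, YoungDiagram.mem_iff_lt_colLen]
      have h2 := hcol (j - d)
      by_cases h : j - d < lam.rowLen (d - 1 - i)
      · have := h1.mp h
        omega
      · have : ¬ d - 1 - i < lam.colLen (j - d) := fun h' => h (h1.mpr h')
        omega
    · omega
    · have := lam.colLen_anti (i - d) (j - d) (by omega)
      have := hcol (i - d)
      omega
  rcases lt_trichotomy i j with h' | h' | h'
  · exact absurd h (key h')
  · exact h'
  · exact absurd h.symm (key h')

/-- The permutation of `{0, …, d + c - 1}` given by `mayaSeq`. -/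
def mayaPerm (d c : ℕ) (lam : YoungDiagram) (hr : lam.rowLen 0 ≤ c) (hc : lam.colLen 0 ≤ d) :
    Equiv.Perm (Fin (d + c)) :=
  Equiv.ofBijective (fun j => ⟨mayaSeq d lam j, mayaSeq_lt hr j.2⟩)
    (Finite.injective_iff_bijective.mp fun _ _ h =>
      Fin.ext (mayaSeq_inj hc (congrArg Fin.val h)))

theorem coe_mayaPerm (hr : lam.rowLen 0 ≤ c) (hc : lam.colLen 0 ≤ d) (j : Fin (d + c)) :
    ((mayaPerm d c lam hr hc j : Fin (d + c)) : ℕ) = mayaSeq d lam j := rfl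

/-- Place d + k of the second block is the larger index of exactly λ'_k inversions, the columns k
being counted from 0. -/
theorem sign_mayaPerm (hr : lam.rowLen 0 ≤ c) (hc : lam.colLen 0 ≤ d) :
    Equiv.Perm.sign (mayaPerm d c lam hr hc) = ∏ i : Fin c, (-1) ^ lam.colLen i := by
  have key (j : Fin (d + c)) : (∏ i ∈ Finset.Iio j,
      (if mayaPerm d c lam hr hc i < mayaPerm d c lam hr hc j then (1 : ℤˣ) else -1)) =
        if (j : ℕ) < d then 1 else (-1) ^ lam.colLen ((j : ℕ) - d) := by
    have h1 (i : Fin (d + c)) (hi : i ∈ Finset.Iio j) :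
        (if mayaPerm d c lam hr hc i < mayaPerm d c lam hr hc j then (1 : ℤˣ) else -1) =
        if ((i : ℕ) < d ∧ d ≤ j ∧ d - lam.colLen (j - d) ≤ i) then -1 else 1 := by
      have := mayaSeq_lt_mayaSeq (lam := lam) (Fin.lt_def.mp (Finset.mem_Iio.mp hi)) hc
      simp only [Fin.lt_def, coe_mayaPerm, this]
      split_ifs <;> tauto
    rw [Finset.prod_congr rfl h1]
    split_ifs with hj
    · exact Finset.prod_eq_one fun i _ => if_neg fun h => by omega
    · rw [← Finset.prod_filter, Finset.prod_const]
      congr 1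
      have hcol : lam.colLen (j - d) ≤ d := (lam.colLen_anti 0 _ (Nat.zero_le _)).trans hc
      rw [← Finset.card_map Fin.valEmbedding]
      have : (Finset.filter (fun i : Fin (d + c) => (i : ℕ) < d ∧ d ≤ (j : ℕ) ∧
          d - lam.colLen (j - d) ≤ (i : ℕ)) (Finset.Iio j)).map Fin.valEmbedding =
          Finset.Ico (d - lam.colLen (j - d)) d := by
        ext x
        simp only [Finset.mem_map, Finset.mem_filter, Finset.mem_Iio, Fin.valEmbedding_apply,
          Finset.mem_Ico, Fin.lt_def]
        constructor
        · rintro ⟨i, hi, rfl⟩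
          omega
        · intro hx
          exact ⟨⟨x, by omega⟩, by dsimp only; omega, rfl⟩
      rw [this, Nat.card_Ico]
      omega
  rw [Equiv.Perm.sign_eq_prod_prod_Iio, Finset.prod_congr rfl fun j _ => key j, Fin.prod_univ_add]
  simp

end Shuffle

section Determinants

variable {R : Type*} [CommRing R]

/-- Removes the trivial rows of a partition padded by zero parts; it gives the Jacobi-Trudi type
determinants a size independent of λ. -/
theorem det_extend (M : ℕ → ℕ → R) {l c : ℕ} (hlc : l ≤ c) (h0 : ∀ i j, l ≤ i → j < i → M i j = 0)
    (h1 : ∀ i, l ≤ i → M i i = 1) :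
    Matrix.det (Matrix.of fun i j : Fin c => M i j) =
      Matrix.det (Matrix.of fun i j : Fin l => M i j) := by
  induction c, hlc using Nat.le_induction with
  | base => rfl
  | succ c hlc ih =>
    rw [← ih, Matrix.det_succ_row _ (Fin.last c), Finset.sum_eq_single (Fin.last c)]
    · simp only [Matrix.of_apply, Fin.val_last, h1 c hlc, mul_one]
      rw [← two_mul, pow_mul]
      simp only [even_two, Even.neg_pow, one_pow, one_mul]
      congr 1
      ext i j
      simp
    · intro j _ hj
      have : (j : ℕ) < c := Fin.val_lt_last hj
      simp [h0 c j hlc this]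
    · simp

theorem det_block_identity {d c : ℕ} (M : Matrix (Fin (d + c)) (Fin (d + c)) R)
    (h : ∀ (i : Fin (d + c)) (j : Fin d), M i (Fin.castAdd c j) = if (i : ℕ) = j then 1 else 0) :
    M.det = Matrix.det (Matrix.of fun i j : Fin c => M (Fin.natAdd d i) (Fin.natAdd d j)) := by
  rw [← Matrix.det_submatrix_equiv_self finSumFinEquiv M,
    ← Matrix.fromBlocks_toBlocks (M.submatrix finSumFinEquiv finSumFinEquiv)]
  have h11 : (M.submatrix finSumFinEquiv finSumFinEquiv).toBlocks₁₁ = 1 := by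
    ext i j
    simp [Matrix.toBlocks₁₁, h, Matrix.one_apply, Fin.ext_iff]
  have h21 : (M.submatrix finSumFinEquiv finSumFinEquiv).toBlocks₂₁ = 0 := by
    ext i j
    have : ¬ d + (i : ℕ) = j := by omega
    simp [Matrix.toBlocks₂₁, h, this]
  rw [h11, h21, Matrix.det_fromBlocks_zero₂₁, Matrix.det_one, one_mul]
  rfl

end Determinants

/-! ### The quantized Schur determinant as a quotient of coordinate determinants. -/

section QuantumSchur

variable {R : Type*} [CommRing R] {φ : R⟦X⟧} {z Q : ℕ → R}

theorem coordForm_zetaSeq_mul (n : ℕ) (ψ : R⟦X⟧) (hψ : PowerSeries.constantCoeff ψ = 1) :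
    coordForm R n (fun j => zetaSeq R j * ψ) = 1 := by
  have : (fun j : Fin n => zetaSeq R j * ψ) = fun j : Fin n => ψ * zetaSeq R j :=
    funext fun j => mul_comm _ _
  rw [this, coordForm_mul_left ψ hψ, coordForm_one_add_X_pow]

theorem todaPair_coeff' (z Q : ℕ → R) (m r : ℕ) :
    (todaPair z Q m).1.coeff r = (-1) ^ (m + r) * todaF z Q m ((m : ℤ) - r) := by
  rcases le_or_gt r m with h | h
  · rw [todaPair_coeff z Q h]
    congr 1
    rw [show m + r = m - r + 2 * r by omega, pow_add, pow_mul]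
    simp
  · rw [todaF_eq_zero_of_neg _ _ _ (by omega), mul_zero]
    exact Polynomial.coeff_eq_zero_of_natDegree_lt
      (lt_of_le_of_lt (todaPair_natDegree_le z Q m).1 h)

/-- The columns ζ^{μ_j} ψ (j < d) and P_j ψ (j ≥ d), with ψ = ζφ, are expanded in two ways. Over the
basis ζ^r ψ the coefficients are those of the P_j, that is, signed F's; over the columns `g` the
transition matrix is triangular. -/
theorem det_todaF_mul_tauDet {d c : ℕ} (hn : 1 ≤ d + c) (hφ : PowerSeries.constantCoeff φ = 1)
    (hσ : ∀ m ≤ d + c, IsUnit (sigmaDet (d + c) φ m))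
    (hτ : ∀ m ≤ d + c, IsUnit (tauDet (d + c) φ m))
    (hz : ∀ m < d + c, z (m + 1) * (tauDet (d + c) φ m * sigmaDet (d + c) φ (m + 1)) =
      tauDet (d + c) φ (m + 1) * sigmaDet (d + c) φ m)
    (hQ : ∀ m, m + 1 < d + c → Q (m + 1) * tauDet (d + c) φ (m + 1) ^ 2 =
      tauDet (d + c) φ m * tauDet (d + c) φ (m + 2))
    {lam : YoungDiagram} (hr : lam.rowLen 0 ≤ c) (hc : lam.colLen 0 ≤ d) :
    Matrix.det (Matrix.of fun i j : Fin (lam.rowLen 0) =>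
        todaF z Q (d + j) ((lam.colLen i : ℤ) - (i : ℤ) + (j : ℤ))) * tauDet (d + c) φ d =
      coordForm R (d + c) fun j => if (j : ℕ) < d then
        zetaSeq R (lam.rowLen (d - 1 - j) + j) * ((1 + PowerSeries.X) * φ) else zetaSeq R j := by
  set n := d + c
  set ψ : R⟦X⟧ := (1 + PowerSeries.X) * φ
  have hψ : PowerSeries.constantCoeff ψ = 1 := by simp [ψ, hφ]
  have hcol (k : ℕ) : lam.colLen k ≤ d := (lam.colLen_anti 0 k (Nat.zero_le _)).trans hc
  -- The value 0 for m ≥ n only makes the choice of coefficients total in m.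
  have hex (m : ℕ) : ∃ α : ℕ → R, m < n → PowerSeries.X ^ n ∣
      Polynomial.aeval (1 + PowerSeries.X : R⟦X⟧) (todaPair z Q m).1 * ψ -
        ∑ j ∈ Finset.Ico m n, α j • zetaSeq R j := by
    by_cases hm : m < n
    · obtain ⟨α, hα⟩ := (todaPair_expansion hn hσ hτ hz hQ m hm.le).1 hm
      exact ⟨α, fun _ => hα⟩
    · exact ⟨0, fun h => absurd h hm⟩
  choose α hα using hex
  have hα0 (m : ℕ) (hm : m < n) : α m m * tauDet n φ m = tauDet n φ (m + 1) :=
    mixedDet_succ hm (aeval_todaPair z Q m _).1 (hα m hm)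
  set g : Fin n → R⟦X⟧ := fun j => if (j : ℕ) < d then
    zetaSeq R (lam.rowLen (d - 1 - j) + j) * ψ else zetaSeq R j
  set C : Matrix (Fin n) (Fin n) R := Matrix.of fun r j => if (j : ℕ) < d then
    (if (r : ℕ) = mayaSeq d lam j then 1 else 0) else (todaPair z Q j).1.coeff r
  set T : Matrix (Fin n) (Fin n) R := Matrix.of fun k j => if (j : ℕ) < d then
    (if k = j then 1 else 0) else if j ≤ k then α j k else 0
  have hC1 : coordForm R n (fun j => ∑ r, C r j • (zetaSeq R r * ψ)) = C.det := by
    rw [coordForm_sum_smul C fun r : Fin n => zetaSeq R r * ψ, coordForm_zetaSeq_mul n ψ hψ, mul_one]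
  have hT1 : coordForm R n (fun j => ∑ k, T k j • g k) = T.det * coordForm R n g :=
    coordForm_sum_smul T g
  have hCT : coordForm R n (fun j => ∑ r, C r j • (zetaSeq R r * ψ)) =
      coordForm R n (fun j => ∑ k, T k j • g k) := by
    refine coordForm_congr fun j => ?_
    by_cases hj : (j : ℕ) < d
    · have e1 : ∑ r, C r j • (zetaSeq R r * ψ) = g j := by
        rw [Finset.sum_eq_single (⟨mayaSeq d lam j, mayaSeq_lt hr j.2⟩ : Fin n)]
        · simp [C, g, hj, mayaSeq]
        · intro r _ hne
          have : (r : ℕ) ≠ mayaSeq d lam j := fun h => hne (Fin.ext h)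
          simp [C, hj, this]
        · simp
      have e2 : ∑ k, T k j • g k = g j := by
        rw [Finset.sum_eq_single j]
        · simp [T, hj]
        · intro k _ hne
          simp [T, hj, hne]
        · simp
      rw [e1, e2, sub_self]
      exact dvd_zero _
    · have e1 : ∑ r, C r j • (zetaSeq R r * ψ) =
          Polynomial.aeval (1 + PowerSeries.X : R⟦X⟧) (todaPair z Q j).1 * ψ := by
        rw [Polynomial.aeval_eq_sum_range' (lt_of_le_of_lt (todaPair_natDegree_le z Q j).1 j.2),
          Finset.sum_mul, Finset.sum_range]
        simp [C, hj]
      have e2 : ∑ k, T k j • g k = ∑ k ∈ Finset.Ico (j : ℕ) n, α j k • zetaSeq R k := by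
        have : Finset.Ico (j : ℕ) n = (Finset.range n).filter fun k => (j : ℕ) ≤ k := by
          ext k; simp only [Finset.mem_Ico, Finset.mem_filter, Finset.mem_range]; tauto
        rw [this, Finset.sum_filter, Finset.sum_range]
        refine Finset.sum_congr rfl fun k _ => ?_
        by_cases hk : j ≤ k
        · have hk' : ¬ (k : ℕ) < d := by have := Fin.le_def.mp hk; omega
          simp [T, g, hj, hk, hk']
        · simp [T, hj, hk]
      rw [e1, e2]
      exact hα j j.2
  -- The diagonal entries τ_{j+1}/τ_j for d ≤ j < n telescope to τ_n/τ_d, and τ_n = 1.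
  have hTdet : T.det * tauDet n φ d = 1 := by
    rw [Matrix.det_of_isLowerTriangular, Fin.prod_univ_add]
    · have hprod (e : ℕ) (he : e ≤ c) : (∏ i ∈ Finset.range e, α (d + i) (d + i)) * tauDet n φ d =
          tauDet n φ (d + e) := by
        induction e with
        | zero => simp
        | succ e ih =>
          rw [Finset.prod_range_succ, mul_right_comm, ih (by omega), mul_comm,
            hα0 (d + e) (by omega)]
          rfl
      have h1 : tauDet n φ n = 1 := by
        rw [← coordForm_zetaSeq_mul n ψ hψ]
        exact congrArg _ (funext fun j => if_pos j.2)
      rw [← h1, ← hprod c le_rfl, Finset.prod_range]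
      simp [T]
    · intro i j hij
      have hij : i < j := hij
      by_cases hj : (j : ℕ) < d
      · simp [T, hj, hij.ne]
      · simp [T, hj, not_le.mpr hij]
  have hCdet : C.det = Matrix.det (Matrix.of fun i j : Fin c =>
      todaF z Q (d + j) ((lam.colLen i : ℤ) - (i : ℤ) + (j : ℤ))) := by
    -- After the rows are permuted by `mayaPerm`, the first d columns are those of the identity.
    -- Only the rows missing from μ and the columns P_j remain.
    have hperm := Matrix.det_permute (mayaPerm d c lam hr hc) C
    rw [det_block_identity] at hperm
    · have hM : (Matrix.of fun i j : Fin c => (C.submatrix (mayaPerm d c lam hr hc) id)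
          (Fin.natAdd d i) (Fin.natAdd d j)) = Matrix.of fun i j : Fin c =>
          ((-1) ^ ((i : ℕ) + lam.colLen i)) * (Matrix.of fun i j : Fin c => ((-1) ^ (j : ℕ)) *
            (Matrix.of fun i j : Fin c =>
              todaF z Q (d + j) ((lam.colLen i : ℤ) - (i : ℤ) + (j : ℤ))) i j) i j := by
        ext i j
        have hci := hcol i
        have hmi : mayaSeq d lam (d + i) = d - lam.colLen i + i := by simp [mayaSeq]
        simp only [C, Matrix.of_apply, Matrix.submatrix_apply, coe_mayaPerm, Fin.val_natAdd, id,
          hmi, not_lt.mpr (Nat.le_add_right d (j : ℕ)), if_false, todaPair_coeff']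
        rw [← mul_assoc, ← pow_add]
        congr 1
        -- Adding the even number 2λ'_i to the exponent removes the truncated subtraction.
        · have : d + (j : ℕ) + (d - lam.colLen i + i) + 2 * lam.colLen i =
            2 * d + (i + lam.colLen i + j) := by omega
          have h2 : (-1 : R) ^ (d + (j : ℕ) + (d - lam.colLen i + i) + 2 * lam.colLen i) =
            (-1) ^ (2 * d + (i + lam.colLen i + j)) := by rw [this]
          simpa [pow_add _ _ (2 * lam.colLen i), pow_add _ (2 * d), pow_mul] using h2
        · congr 1
          push_cast [Nat.cast_sub hci]
          ring
      rw [hM, Matrix.det_mul_column, Matrix.det_mul_row, sign_mayaPerm] at hperm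
      have hs : (((∏ i : Fin c, (-1) ^ lam.colLen i : ℤˣ) : ℤ) : R) =
          ∏ i : Fin c, (-1) ^ lam.colLen i := by simp
      rw [hs] at hperm
      have h2 : (∏ i : Fin c, (-1 : R) ^ ((i : ℕ) + lam.colLen i)) * (∏ i : Fin c, (-1) ^ (i : ℕ)) =
          ∏ i : Fin c, (-1) ^ lam.colLen i := by
        rw [← Finset.prod_mul_distrib]
        refine Finset.prod_congr rfl fun i _ => ?_
        rw [pow_add, mul_right_comm, ← pow_add, ← two_mul, pow_mul]
        simp
      rw [← mul_assoc, h2] at hperm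
      have hu : IsUnit (∏ i : Fin c, (-1 : R) ^ lam.colLen i) := by
        rw [Finset.prod_pow_eq_pow_sum]
        exact isUnit_one.neg.pow _
      exact (hu.mul_left_cancel hperm).symm
    · intro i j
      have hj : mayaSeq d lam i = mayaSeq d lam j ↔ (i : ℕ) = j :=
        ⟨mayaSeq_inj hc, fun h => by rw [h]⟩
      simp [C, coe_mayaPerm, hj]
  have hext := det_extend (fun i j => todaF z Q (d + j) ((lam.colLen i : ℤ) - (i : ℤ) + (j : ℤ))) hr
    (fun i j hi hji => by
      have : lam.colLen i = 0 := by
        by_contra h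
        have := (YoungDiagram.mem_iff_lt_rowLen.mp
          (YoungDiagram.mem_iff_lt_colLen.mpr (Nat.pos_of_ne_zero h)))
        omega
      rw [this]
      exact todaF_eq_zero_of_neg _ _ _ (by push_cast; omega))
    (fun i hi => by
      have : lam.colLen i = 0 := by
        by_contra h
        have := (YoungDiagram.mem_iff_lt_rowLen.mp
          (YoungDiagram.mem_iff_lt_colLen.mpr (Nat.pos_of_ne_zero h)))
        omega
      rw [this]
      simpa using todaF_zero z Q (d + i))
  have key : T.det * coordForm R n g = C.det := by rw [← hT1, ← hCT, hC1]
  rw [← hext, ← hCdet, ← key, mul_right_comm, hTdet, one_mul]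

end QuantumSchur

/-! ### Adjoints of the power sums. -/

section Perp

theorem perp_one (g : Lam) : perp 1 g = g :=
  (perp_unique 1 g g fun u => by rw [one_mul]).symm

theorem perp_mul (f g h : Lam) : perp (f * g) h = perp f (perp g h) :=
  (perp_unique (f * g) h _ fun u => by
    rw [hall_perp, hall_perp, ← mul_assoc, mul_comm g f]).symm

theorem zNumber_add_single (m : ℕ+ →₀ ℕ) (i : ℕ+) :
    zNumber (m + Finsupp.single i 1) = ((i : ℕ) : ℂ) * (m i + 1) * zNumber m := by
  classical
  have h (m' : ℕ+ →₀ ℕ) (hs : m'.support ⊆ insert i m.support) : zNumber m' =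
      ∏ j ∈ insert i m.support, ((j : ℕ) : ℂ) ^ m' j * ((m' j).factorial : ℂ) :=
    Finsupp.prod_of_support_subset _ hs _ fun _ _ => by simp
  have hs : (m + Finsupp.single i 1).support ⊆ insert i m.support := by
    refine Finsupp.support_add.trans ?_
    intro j hj
    rcases Finset.mem_union.mp hj with hj | hj
    · exact Finset.mem_insert_of_mem hj
    · have := Finsupp.support_single_subset hj
      exact Finset.mem_insert.mpr (Or.inl (Finset.mem_singleton.mp this))
  rw [h _ hs, h m (Finset.subset_insert _ _), ← Finset.mul_prod_erase _ _ (Finset.mem_insert_self i _),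
    ← Finset.mul_prod_erase _ _ (Finset.mem_insert_self i _), ← mul_assoc]
  congr 1
  · rw [Finsupp.add_apply, Finsupp.single_eq_same, Nat.factorial_succ, pow_succ]
    push_cast
    ring
  · refine Finset.prod_congr rfl fun j hj => ?_
    rw [Finsupp.add_apply, Finsupp.single_eq_of_ne (Finset.ne_of_mem_erase hj), add_zero]

/-- The derivation `k ∂/∂p_k` of `Λ`. -/
def psumDeriv (k : ℕ+) : Derivation ℂ Lam Lam := ((k : ℕ) : ℂ) • MvPolynomial.pderiv k

/-- On monomials this is the ratio z_{m + e_k}/z_m = k(m_k + 1), the factor produced by k ∂/∂p_k. -/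
theorem perp_X (k : ℕ+) (g : Lam) : perp (MvPolynomial.X k) g = psumDeriv k g := by
  classical
  induction g using MvPolynomial.induction_on' with
  | add p q hp hq => rw [map_add, map_add, hp, hq]
  | monomial b s =>
    have hs : (MvPolynomial.monomial b s : Lam) = s • MvPolynomial.monomial b 1 := by
      rw [MvPolynomial.smul_monomial, smul_eq_mul, mul_one]
    rw [hs, map_smul, Derivation.map_smul]
    congr 1
    rw [MvPolynomial.X, perp_monomial, psumDeriv, Derivation.smul_apply,
      MvPolynomial.pderiv_monomial, MvPolynomial.smul_monomial]
    split_ifs with h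
    · congr 1
      obtain ⟨c, rfl⟩ := exists_add_of_le h
      rw [add_tsub_cancel_left, add_comm _ c, zNumber_add_single, mul_div_assoc,
        div_self (zNumber_ne_zero c)]
      simp
    · have : b k = 0 := by
        by_contra hb
        exact h (Finsupp.single_le_iff.mpr (Nat.one_le_iff_ne_zero.mpr hb))
      simp [this]

theorem psum_coe (k : ℕ+) : psum k = MvPolynomial.X k := by
  rw [psum, dif_pos k.pos]
  rfl

theorem psumDeriv_psum (k : ℕ+) (i : ℕ) :
    psumDeriv k (psum i) = if i = k then (k : Lam) else 0 := by
  classical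
  rw [psum]
  split_ifs with h1 h2 h2
  · have : (⟨i, h1⟩ : ℕ+) = k := PNat.eq h2
    rw [this, psumDeriv, Derivation.smul_apply, MvPolynomial.pderiv_X_self, Algebra.smul_def,
      mul_one]
    simp
  · have : (⟨i, h1⟩ : ℕ+) ≠ k := fun h => h2 (congrArg PNat.val h)
    exact (congrArg (((k : ℕ) : ℂ) • ·) (MvPolynomial.pderiv_X_of_ne this)).trans (smul_zero _)
  · exact absurd k.pos (h2 ▸ h1)
  · exact map_zero _

theorem complete_zero : complete 0 = 1 := by rw [complete]

theorem succ_mul_complete (m : ℕ) : ((m + 1 : ℕ) : Lam) * complete (m + 1) =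
    ∑ i ∈ Finset.range (m + 1), psum (i + 1) * complete (m - i) := by
  rw [complete, ← mul_assoc, Finset.sum_range]
  have : ((m + 1 : ℕ) : Lam) = MvPolynomial.C ((m : ℂ) + 1) := by simp
  rw [this, ← map_mul, mul_one_div_cancel (Nat.cast_add_one_ne_zero m), map_one, one_mul]

/-- Differentiate Newton's identity for (m+1) h_{m+1}. By induction the terms p_i h_{m+1-i}
contribute (m+1-k) h_{m+1-k}, and the derivative of p_k contributes k h_{m+1-k}. -/
theorem psumDeriv_complete (k : ℕ+) (m : ℕ) :
    psumDeriv k (complete m) = if (k : ℕ) ≤ m then complete (m - k) else 0 := by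
  induction m using Nat.strong_induction_on with
  | _ m ih =>
    cases m with
    | zero => rw [complete_zero, Derivation.map_one_eq_zero, if_neg (by have := k.pos; omega)]
    | succ m =>
      have hk := k.pos
      have h0 : ((m + 1 : ℕ) : Lam) ≠ 0 := Nat.cast_ne_zero.mpr (Nat.succ_ne_zero m)
      refine mul_left_cancel₀ h0 ?_
      have h := congrArg (psumDeriv k) (succ_mul_complete m)
      rw [Derivation.leibniz, Derivation.map_natCast, smul_zero, add_zero, smul_eq_mul] at h
      rw [h, map_sum]
      have h1 (i : ℕ) (hi : i ∈ Finset.range (m + 1)) :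
          psumDeriv k (psum (i + 1) * complete (m - i)) =
          (if (k : ℕ) ≤ m - i then psum (i + 1) * complete (m - i - k) else 0) +
            if i + 1 = (k : ℕ) then (k : Lam) * complete (m - i) else 0 := by
        rw [Derivation.leibniz, ih (m - i) (by omega), psumDeriv_psum]
        split_ifs <;> simp [mul_comm]
      rw [Finset.sum_congr rfl h1, Finset.sum_add_distrib]
      by_cases hkm : (k : ℕ) ≤ m
      · rw [if_pos (by omega), ← Finset.sum_filter, ← Finset.sum_filter]
        have f1 : (Finset.range (m + 1)).filter (fun i => (k : ℕ) ≤ m - i) =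
            Finset.range (m - k + 1) := by
          ext i; simp only [Finset.mem_filter, Finset.mem_range]; omega
        have f2 : (Finset.range (m + 1)).filter (fun i => i + 1 = (k : ℕ)) = {(k : ℕ) - 1} := by
          ext i; simp only [Finset.mem_filter, Finset.mem_range, Finset.mem_singleton]; omega
        have f3 : ∑ i ∈ Finset.range (m - k + 1), psum (i + 1) * complete (m - i - k) =
            ((m - k + 1 : ℕ) : Lam) * complete (m - k + 1) := by
          rw [succ_mul_complete]
          exact Finset.sum_congr rfl fun i _ => by rw [Nat.sub_right_comm]
        rw [f1, f2, f3, Finset.sum_singleton, show m - (k - 1) = m - k + 1 by omega,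
          show m + 1 - k = m - k + 1 by omega, ← add_mul]
        congr 1
        rw [← Nat.cast_add]
        congr 1
        omega
      · rw [Finset.sum_eq_zero fun i _ => if_neg (by omega), zero_add]
        by_cases hkm1 : (k : ℕ) = m + 1
        · rw [if_pos hkm1.le, Finset.sum_eq_single m]
          · simp [hkm1]
          · intro i _ hi
            rw [if_neg (by omega)]
          · simp
        · rw [if_neg (by omega), mul_zero]
          exact Finset.sum_eq_zero fun i hi => if_neg (by
            have := Finset.mem_range.mp hi; omega)

end Perp

/-! ### Action of the adjoints on determinants indexed by monomials. -/

section DerivationDet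

variable {A : Type*} [CommRing A] [Algebra ℂ A]

theorem derivation_prod {ι : Type*} [DecidableEq ι] (D : Derivation ℂ A A) (s : Finset ι)
    (f : ι → A) : D (∏ i ∈ s, f i) = ∑ j ∈ s, ∏ i ∈ s, if i = j then D (f i) else f i := by
  induction s using Finset.induction_on with
  | empty => simp
  | insert a s ha ih =>
    rw [Finset.prod_insert ha, Derivation.leibniz, ih, Finset.sum_insert ha, Finset.prod_insert ha,
      if_pos rfl, smul_eq_mul, smul_eq_mul, add_comm, Finset.mul_sum]
    congr 1
    · rw [mul_comm]
      congr 1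
      exact Finset.prod_congr rfl fun i hi => (if_neg (ne_of_mem_of_not_mem hi ha)).symm
    · refine Finset.sum_congr rfl fun j hj => ?_
      rw [Finset.prod_insert ha, if_neg (ne_of_mem_of_not_mem hj ha).symm]

theorem derivation_coordForm (D : Derivation ℂ A A) {n : ℕ} (f f' : Fin n → A⟦X⟧)
    (h : ∀ j i, PowerSeries.coeff i (f' j) = D (PowerSeries.coeff i (f j))) :
    D (coordForm A n f) = ∑ j, coordForm A n (Function.update f j (f' j)) := by
  simp only [coordForm_apply, Matrix.det_apply, map_sum]
  rw [Finset.sum_comm]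
  refine Finset.sum_congr rfl fun σ _ => ?_
  rw [Units.smul_def, map_zsmul, derivation_prod, ← Finset.smul_sum]
  congr 1
  refine Finset.sum_congr rfl fun j _ => Finset.prod_congr rfl fun i _ => ?_
  by_cases hij : i = j
  · subst hij
    simp [h]
  · simp [hij]

end DerivationDet

section Alternants

/-- The series `∑_k (-1)^k h_k X^k`. -/
def completeSeries : Lam⟦X⟧ := PowerSeries.mk fun k => (-1) ^ k * complete k

/-- The series `ζ^{1-d} φ` in `ζ - 1`, without truncation of `φ`. -/
def baseSeries (d : ℕ) : Lam⟦X⟧ :=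
  PowerSeries.binomialSeries Lam (1 - (d : ℤ)) * completeSeries

theorem zetaSeq_eq_binomialSeries (R : Type*) [CommRing R] (e : ℕ) :
    zetaSeq R e = PowerSeries.binomialSeries R (e : ℤ) :=
  (PowerSeries.binomialSeries_nat (R := ℤ) e).symm

theorem coeff_neg_X_pow_mul {R : Type*} [CommRing R] (k i : ℕ) (f : R⟦X⟧) :
    PowerSeries.coeff i ((-PowerSeries.X) ^ k * f) =
      if k ≤ i then (-1) ^ k * PowerSeries.coeff (i - k) f else 0 := by
  have h : ((-PowerSeries.X) ^ k * f : R⟦X⟧) =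
      PowerSeries.C ((-1) ^ k) * (PowerSeries.X ^ k * f) := by
    rw [neg_pow, map_pow, map_neg, map_one, mul_assoc]
  rw [h, PowerSeries.coeff_C_mul, PowerSeries.coeff_X_pow_mul']
  split_ifs <;> simp

theorem psumDeriv_neg_one_pow_mul (k : ℕ+) (i : ℕ) (f : Lam) :
    psumDeriv k ((-1) ^ i * f) = (-1) ^ i * psumDeriv k f := by
  rcases neg_one_pow_eq_or Lam i with h | h <;> rw [h]
  · simp
  · simp

theorem psumDeriv_coeff_completeSeries (k : ℕ+) (i : ℕ) :
    psumDeriv k (PowerSeries.coeff i completeSeries) =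
      PowerSeries.coeff i ((-PowerSeries.X) ^ (k : ℕ) * completeSeries) := by
  rw [coeff_neg_X_pow_mul, completeSeries, PowerSeries.coeff_mk, psumDeriv_neg_one_pow_mul,
    psumDeriv_complete]
  split_ifs with h
  · rw [PowerSeries.coeff_mk, ← mul_assoc, ← pow_add, Nat.add_sub_cancel' h]
  · rw [mul_zero]

/-- Powers of ζ have integer coefficients, so the derivation sees only Σ (-1)^i h_i X^i, where it is
multiplication by (-X)^k. -/
theorem psumDeriv_coeff_mul_baseSeries (k : ℕ+) (d e i : ℕ) :
    psumDeriv k (PowerSeries.coeff i (zetaSeq Lam e * baseSeries d)) =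
      PowerSeries.coeff i ((-PowerSeries.X) ^ (k : ℕ) * (zetaSeq Lam e * baseSeries d)) := by
  rw [baseSeries, zetaSeq_eq_binomialSeries, ← mul_assoc, ← PowerSeries.binomialSeries_add,
    mul_left_comm, PowerSeries.coeff_mul, PowerSeries.coeff_mul, map_sum]
  refine Finset.sum_congr rfl fun p _ => ?_
  rw [Derivation.leibniz, psumDeriv_coeff_completeSeries, PowerSeries.binomialSeries_coeff,
    map_zsmul, Derivation.map_one_eq_zero, smul_zero, smul_zero, add_zero, smul_eq_mul]

variable (d c : ℕ)

/-- The determinant `|f_1, …, f_d, 1, ζ, …, ζ^{c-1}|`. -/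
def flagDet (f : Fin d → Lam⟦X⟧) : Lam :=
  coordForm Lam (d + c) (Fin.append f fun k : Fin c => zetaSeq Lam k)

variable {d c}

theorem append_update {α : Type*} (f : Fin d → α) (g : Fin c → α) (a : Fin d) (v : α) :
    Fin.append (Function.update f a v) g =
      Function.update (Fin.append f g) (Fin.castAdd c a) v := by
  ext1 j
  refine Fin.addCases (fun i => ?_) (fun i => ?_) j
  · rw [Fin.append_left]
    by_cases h : i = a
    · subst h; simp
    · have : Fin.castAdd c i ≠ Fin.castAdd c a := fun h' => h (Fin.castAdd_injective _ _ h')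
      rw [Function.update_of_ne h, Function.update_of_ne this, Fin.append_left]
  · have : Fin.natAdd d i ≠ Fin.castAdd c a := fun h' => by
      have := congrArg Fin.val h'
      simp at this
      omega
    rw [Fin.append_right, Function.update_of_ne this, Fin.append_right]

theorem flagDet_update_sum (f : Fin d → Lam⟦X⟧) (a : Fin d) {κ : Type*} (s : Finset κ)
    (r : κ → Lam) (w : κ → Lam⟦X⟧) :
    flagDet d c (Function.update f a (∑ k ∈ s, r k • w k)) =
      ∑ k ∈ s, r k * flagDet d c (Function.update f a (w k)) := by
  simp only [flagDet, append_update]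
  rw [AlternatingMap.map_update_sum]
  exact Finset.sum_congr rfl fun k _ => by rw [AlternatingMap.map_update_smul, smul_eq_mul]

theorem flagDet_perm (f : Fin d → Lam⟦X⟧) (σ : Equiv.Perm (Fin d)) :
    flagDet d c (f ∘ σ) = ((Equiv.Perm.sign σ : ℤˣ) : ℤ) • flagDet d c f := by
  have h : (Fin.append (f ∘ σ) fun k : Fin c => zetaSeq Lam k) =
      (Fin.append f fun k : Fin c => zetaSeq Lam k) ∘
        (finSumFinEquiv.permCongr (Equiv.Perm.sumCongr σ 1)) := by
    ext1 j
    refine Fin.addCases (fun i => ?_) (fun i => ?_) j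
    · simp [Equiv.permCongr_apply]
    · simp [Equiv.permCongr_apply]
  rw [flagDet, h, AlternatingMap.map_perm, Equiv.Perm.sign_permCongr, Equiv.Perm.sign_sumCongr]
  simp [flagDet, Units.smul_def]

variable (d c)

/-- The linear map `X^e ↦ |ζ^{e_1 + 1 - d} φ, …, ζ^{e_d + 1 - d} φ, 1, ζ, …, ζ^{c-1}|`. -/
def alternantMap : MvPolynomial (Fin d) ℂ →ₗ[ℂ] Lam :=
  (MvPolynomial.basisMonomials (Fin d) ℂ).constr ℂ fun e =>
    flagDet d c fun a => zetaSeq Lam (e a) * baseSeries d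

theorem alternantMap_monomial (e : Fin d →₀ ℕ) :
    alternantMap d c (MvPolynomial.monomial e 1) =
      flagDet d c fun a => zetaSeq Lam (e a) * baseSeries d := by
  have h := (MvPolynomial.basisMonomials (Fin d) ℂ).constr_basis ℂ
    (fun e => flagDet d c fun a => zetaSeq Lam (e a) * baseSeries d) e
  rwa [MvPolynomial.coe_basisMonomials] at h

theorem one_sub_pow {A : Type*} [CommRing A] (x : A) (k : ℕ) :
    (1 - x) ^ k = ∑ m ∈ Finset.range (k + 1), ((-1) ^ m * (k.choose m : A)) * x ^ m := by
  rw [sub_eq_neg_add, add_pow]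
  refine Finset.sum_congr rfl fun m _ => ?_
  rw [neg_pow]
  ring

theorem psumDeriv_flagDet (k : ℕ+) (e : Fin d → ℕ) :
    psumDeriv k (flagDet d c fun a => zetaSeq Lam (e a) * baseSeries d) =
      ∑ a, flagDet d c (Function.update (fun a => zetaSeq Lam (e a) * baseSeries d) a
        ((-PowerSeries.X) ^ (k : ℕ) * (zetaSeq Lam (e a) * baseSeries d))) := by
  rw [flagDet, derivation_coordForm (psumDeriv k) _ (Fin.append
      (fun a => (-PowerSeries.X) ^ (k : ℕ) * (zetaSeq Lam (e a) * baseSeries d)) fun _ => 0),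
    Fin.sum_univ_add, Finset.sum_eq_zero (s := (Finset.univ : Finset (Fin c))), add_zero]
  · refine Finset.sum_congr rfl fun a _ => ?_
    rw [Fin.append_left, ← append_update, flagDet]
  · intro i _
    rw [Fin.append_right]
    exact AlternatingMap.map_update_zero _ _ _
  · intro j i
    refine Fin.addCases (fun a => ?_) (fun a => ?_) j
    · rw [Fin.append_left, Fin.append_left, psumDeriv_coeff_mul_baseSeries]
    · rw [Fin.append_right, Fin.append_right, zetaSeq_eq_binomialSeries,
        PowerSeries.binomialSeries_coeff, map_zsmul, Derivation.map_one_eq_zero, smul_zero,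
        map_zero]

theorem neg_X_pow_mul_eq_sum {R : Type*} [CommRing R] (k e : ℕ) (f : R⟦X⟧) :
    (-PowerSeries.X) ^ k * (zetaSeq R e * f) =
      ∑ m ∈ Finset.range (k + 1), ((-1) ^ m * ((k.choose m : ℕ) : R)) • (zetaSeq R (e + m) * f) := by
  have : (-PowerSeries.X : R⟦X⟧) = 1 - (1 + PowerSeries.X) := by ring
  rw [this, one_sub_pow, Finset.sum_mul]
  refine Finset.sum_congr rfl fun m _ => ?_
  rw [PowerSeries.smul_eq_C_mul, zetaSeq, zetaSeq, pow_add]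
  simp only [map_mul, map_pow, map_neg, map_one, map_natCast]
  ring

theorem one_sub_X_pow_mul_monomial (k : ℕ) (a : Fin d) (e : Fin d →₀ ℕ) :
    ((1 - MvPolynomial.X a) ^ k * MvPolynomial.monomial e 1 : MvPolynomial (Fin d) ℂ) =
      ∑ m ∈ Finset.range (k + 1), ((-1) ^ m * (k.choose m : ℂ)) •
        MvPolynomial.monomial (e + Finsupp.single a m) 1 := by
  rw [one_sub_pow, Finset.sum_mul]
  refine Finset.sum_congr rfl fun m _ => ?_
  rw [MvPolynomial.X_pow_eq_monomial, mul_assoc, MvPolynomial.monomial_mul, mul_one,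
    add_comm (Finsupp.single a m), MvPolynomial.smul_eq_C_mul]
  simp only [map_mul, map_pow, map_neg, map_one, map_natCast]

theorem smul_eq_natCast_mul (m k : ℕ) (f : Lam) :
    ((-1) ^ m * (k : ℂ)) • f = ((-1) ^ m * (k : Lam)) * f := by
  rw [MvPolynomial.smul_eq_C_mul]
  simp only [map_mul, map_pow, map_neg, map_one, map_natCast]

/-- By the Leibniz rule the derivation multiplies one column at a time by (-X)^k = (1 - ζ)^k.
Multiplying column a by ζ corresponds to multiplying the monomial by x_a, and the columns 1, …,
ζ^{c-1} are constant. -/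
theorem psumDeriv_alternantMap (k : ℕ+) (P : MvPolynomial (Fin d) ℂ) :
    psumDeriv k (alternantMap d c P) =
      alternantMap d c ((∑ a, (1 - MvPolynomial.X a) ^ (k : ℕ)) * P) := by
  induction P using MvPolynomial.induction_on' with
  | add p q hp hq => rw [map_add, map_add, hp, hq, mul_add, map_add]
  | monomial e r =>
    have hs : (MvPolynomial.monomial e r : MvPolynomial (Fin d) ℂ) =
        r • MvPolynomial.monomial e 1 := by
      rw [MvPolynomial.smul_monomial, smul_eq_mul, mul_one]
    rw [hs, map_smul, Derivation.map_smul, mul_smul_comm, map_smul, Finset.sum_mul, map_sum,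
      alternantMap_monomial, psumDeriv_flagDet]
    refine congrArg (r • ·) (Finset.sum_congr rfl fun a _ => ?_)
    rw [one_sub_X_pow_mul_monomial, map_sum, neg_X_pow_mul_eq_sum, flagDet_update_sum]
    refine Finset.sum_congr rfl fun m _ => ?_
    rw [map_smul, alternantMap_monomial, smul_eq_natCast_mul]
    refine congrArg _ (congrArg _ (funext fun b => ?_))
    by_cases hb : b = a
    · subst hb
      rw [Function.update_self, Finsupp.add_apply, Finsupp.single_eq_same]
    · rw [Function.update_of_ne hb, Finsupp.add_apply, Finsupp.single_eq_of_ne hb, add_zero]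

/-- The specialization of a symmetric function to finitely many variables. -/
def specialize : Lam →ₐ[ℂ] MvPolynomial (Fin d) ℂ :=
  MvPolynomial.aeval fun i : ℕ+ => ∑ a, MvPolynomial.X a ^ (i : ℕ)

theorem kappa_X (i : ℕ+) : kappa d (MvPolynomial.X i) = (d : ℂ) • (1 : Lam) +
    ∑ m ∈ Finset.Icc 1 (i : ℕ), ((-1) ^ m * ((i : ℕ).choose m : ℂ)) • psum m := by
  rw [kappa, MvPolynomial.aeval_X]
  congr 1
  · rw [MvPolynomial.smul_eq_C_mul, mul_one, map_natCast]
  · exact Finset.sum_congr rfl fun m _ => (smul_eq_natCast_mul _ _ _).symm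

/-- Writing x = 1 - (1 - x) expresses p_i(x) through the p_m(1 - x) with the coefficients of
κ_d(p_i), which matches `psumDeriv_alternantMap`. -/
theorem specialize_X (i : ℕ+) :
    specialize d (MvPolynomial.X i) = (d : ℂ) • (1 : MvPolynomial (Fin d) ℂ) +
      ∑ m ∈ Finset.Icc 1 (i : ℕ), ((-1) ^ m * ((i : ℕ).choose m : ℂ)) •
        ∑ a, (1 - MvPolynomial.X a) ^ m := by
  rw [specialize, MvPolynomial.aeval_X]
  have h (a : Fin d) : (MvPolynomial.X a : MvPolynomial (Fin d) ℂ) ^ (i : ℕ) = 1 +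
      ∑ m ∈ Finset.Icc 1 (i : ℕ), ((-1) ^ m * ((i : ℕ).choose m : ℂ)) •
        (1 - MvPolynomial.X a) ^ m := by
    have h' := one_sub_pow (1 - MvPolynomial.X a : MvPolynomial (Fin d) ℂ) i
    rw [sub_sub_cancel, Finset.range_eq_Ico, Finset.sum_eq_sum_Ico_succ_bot (by omega)] at h'
    rw [h']
    congr 1
    · simp
    · refine Finset.sum_congr rfl fun m _ => ?_
      rw [MvPolynomial.smul_eq_C_mul]
      simp only [map_mul, map_pow, map_neg, map_one, map_natCast]
  rw [Finset.sum_congr rfl fun a _ => h a, Finset.sum_add_distrib, Finset.sum_comm]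
  congr 1
  · simp [MvPolynomial.smul_eq_C_mul]
  · exact Finset.sum_congr rfl fun m _ => Finset.smul_sum.symm

theorem perp_kappa_X_alternantMap (i : ℕ+) (P : MvPolynomial (Fin d) ℂ) :
    perp (kappa d (MvPolynomial.X i)) (alternantMap d c P) =
      alternantMap d c (specialize d (MvPolynomial.X i) * P) := by
  have hX (m : ℕ) (hm : m ∈ Finset.Icc 1 (i : ℕ)) : perp (psum m) (alternantMap d c P) =
      alternantMap d c ((∑ a, (1 - MvPolynomial.X a) ^ m) * P) := by
    obtain ⟨k, rfl⟩ : ∃ k : ℕ+, (k : ℕ) = m := ⟨⟨m, (Finset.mem_Icc.mp hm).1⟩, rfl⟩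
    rw [psum_coe, perp_X, psumDeriv_alternantMap]
  rw [kappa_X, specialize_X, map_add, LinearMap.add_apply, map_smul, LinearMap.smul_apply, perp_one,
    add_mul, map_add, smul_mul_assoc, one_mul, map_smul, map_sum, LinearMap.sum_apply,
    Finset.sum_mul, map_sum]
  congr 1
  refine Finset.sum_congr rfl fun m hm => ?_
  rw [map_smul, LinearMap.smul_apply, hX m hm, smul_mul_assoc, map_smul]

theorem perp_kappa_alternantMap (f : Lam) (P : MvPolynomial (Fin d) ℂ) :
    perp (kappa d f) (alternantMap d c P) = alternantMap d c (specialize d f * P) := by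
  induction f using MvPolynomial.induction_on generalizing P with
  | C r =>
    have h1 : (MvPolynomial.C r : Lam) = r • 1 := by rw [MvPolynomial.smul_eq_C_mul, mul_one]
    rw [h1, map_smul (kappa d), map_smul (specialize d), map_one (kappa d), map_one (specialize d),
      map_smul perp, LinearMap.smul_apply, perp_one, smul_mul_assoc, one_mul, map_smul]
  | add p q hp hq =>
    rw [map_add, map_add, LinearMap.add_apply, hp, hq, map_add, add_mul, map_add]
  | mul_X p i hp =>
    rw [map_mul (kappa d), perp_mul, map_mul (specialize d), mul_assoc, ← hp,
      perp_kappa_X_alternantMap]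

/-- Each of the d! terms gives the same determinant: the sign of the permutation is cancelled by
reordering the columns. -/
theorem alternantMap_det (e : Fin d → ℕ) :
    alternantMap d c (Matrix.det (Matrix.of fun i a : Fin d => MvPolynomial.X a ^ e i)) =
      (d.factorial : ℂ) • flagDet d c fun a => zetaSeq Lam (e a) * baseSeries d := by
  rw [Matrix.det_apply', map_sum]
  have h (σ : Equiv.Perm (Fin d)) : alternantMap d c (((Equiv.Perm.sign σ : ℤˣ) : ℤ) *
      ∏ i, (Matrix.of fun i a : Fin d => (MvPolynomial.X a : MvPolynomial (Fin d) ℂ) ^ e i) (σ i) i) =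
        flagDet d c fun a => zetaSeq Lam (e a) * baseSeries d := by
    have h1 : ∏ i, (Matrix.of fun i a : Fin d => (MvPolynomial.X a : MvPolynomial (Fin d) ℂ) ^ e i)
        (σ i) i = MvPolynomial.monomial (Finsupp.equivFunOnFinite.symm fun a => e (σ a)) 1 := by
      rw [MvPolynomial.monomial_eq, map_one, one_mul, Finsupp.prod_fintype]
      · rfl
      · simp
    rw [h1, ← zsmul_eq_mul, map_zsmul, alternantMap_monomial]
    have h2 := flagDet_perm (c := c) (fun a => zetaSeq Lam (e a) * baseSeries d) σ
    have h3 : (fun a => zetaSeq Lam ((Finsupp.equivFunOnFinite.symm fun a => e (σ a)) a) *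
        baseSeries d) = (fun a => zetaSeq Lam (e a) * baseSeries d) ∘ σ := rfl
    rw [h3, h2, smul_smul, ← Units.val_mul, Int.units_mul_self, Units.val_one, one_smul]
  rw [Finset.sum_congr rfl fun σ _ => h σ, Finset.sum_const, Finset.card_univ, Fintype.card_perm,
    Fintype.card_fin, ← Nat.cast_smul_eq_nsmul ℂ]

end Alternants

/-! ### The bialternant formula. -/

section Bialternant

variable {A : Type*} [CommRing A]

theorem mk_pow_succ_mul (x : A) :
    (PowerSeries.mk fun i => x ^ (i + 1)) * (1 - PowerSeries.C x * PowerSeries.X) =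
      PowerSeries.C x := by
  ext k
  cases k with
  | zero => simp [mul_sub]
  | succ k =>
    rw [mul_sub, mul_one, map_sub, ← mul_assoc, PowerSeries.coeff_succ_mul_X,
      PowerSeries.coeff_mul_C, PowerSeries.coeff_mk, PowerSeries.coeff_mk, PowerSeries.coeff_C,
      if_neg (Nat.succ_ne_zero k), ← pow_succ, sub_self]

theorem mk_pow_mul (x : A) :
    (PowerSeries.mk fun i => x ^ i) * (1 - PowerSeries.C x * PowerSeries.X) = 1 := by
  ext k
  cases k with
  | zero => simp [mul_sub]
  | succ k =>
    rw [mul_sub, mul_one, map_sub, ← mul_assoc, PowerSeries.coeff_succ_mul_X,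
      PowerSeries.coeff_mul_C, PowerSeries.coeff_mk, PowerSeries.coeff_mk, PowerSeries.coeff_one,
      if_neg (Nat.succ_ne_zero k), ← pow_succ, sub_self]

theorem derivative_prod_one_sub {ι : Type*} (s : Finset ι) (x : ι → A) :
    PowerSeries.derivative A (∏ a ∈ s, (1 - PowerSeries.C (x a) * PowerSeries.X)) =
      -(PowerSeries.mk fun i => ∑ a ∈ s, x a ^ (i + 1)) *
        ∏ a ∈ s, (1 - PowerSeries.C (x a) * PowerSeries.X) := by
  classical
  induction s using Finset.induction_on with
  | empty =>
    have : (PowerSeries.mk fun _ : ℕ => (0 : A)) = 0 := by ext; simp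
    simp [this]
  | insert a s ha ih =>
    have h1 : (PowerSeries.mk fun i => ∑ b ∈ insert a s, x b ^ (i + 1)) =
        (PowerSeries.mk fun i => x a ^ (i + 1)) +
          PowerSeries.mk fun i => ∑ b ∈ s, x b ^ (i + 1) := by
      ext k
      simp [Finset.sum_insert ha]
    have h2 : PowerSeries.derivative A (1 - PowerSeries.C (x a) * PowerSeries.X) =
        -PowerSeries.C (x a) := by
      rw [map_sub, Derivation.map_one_eq_zero, Derivation.leibniz, PowerSeries.derivative_X,
        PowerSeries.derivative_C]
      simp
    rw [Finset.prod_insert ha, Derivation.leibniz, ih, h1, h2]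
    simp only [smul_eq_mul]
    linear_combination (∏ a ∈ s, (1 - PowerSeries.C (x a) * PowerSeries.X)) * mk_pow_succ_mul (x a)

variable (d : ℕ)

/-- The polynomial `∏_{b ≠ a} (1 - X_b T)` in `T`. -/
def coPoly (a : Fin d) : Polynomial (MvPolynomial (Fin d) ℂ) :=
  ∏ b ∈ Finset.univ.erase a, (1 - Polynomial.C (MvPolynomial.X b) * Polynomial.X)

theorem coPoly_coeff_eq_zero (a : Fin d) {s : ℕ} (hs : d ≤ s) : (coPoly d a).coeff s = 0 := by
  refine Polynomial.coeff_eq_zero_of_natDegree_lt (lt_of_le_of_lt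
    (Polynomial.natDegree_prod_le _ _) ?_)
  have h : ∑ b ∈ Finset.univ.erase a, (1 - Polynomial.C (MvPolynomial.X b : MvPolynomial (Fin d) ℂ) *
      Polynomial.X).natDegree ≤ ∑ b ∈ Finset.univ.erase a, 1 := by
    refine Finset.sum_le_sum fun b _ => ?_
    refine (Polynomial.natDegree_sub_le _ _).trans (max_le (by simp) ?_)
    exact (Polynomial.natDegree_C_mul_le _ _).trans Polynomial.natDegree_X_le
  rw [Finset.sum_const, Finset.card_erase_of_mem (Finset.mem_univ a), Finset.card_univ,
    Fintype.card_fin, smul_eq_mul, mul_one] at h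
  have := a.pos
  omega

theorem specialize_psum_succ (i : ℕ) :
    specialize d (psum (i + 1)) = ∑ a, MvPolynomial.X a ^ (i + 1) := by
  have h := psum_coe (Nat.succPNat i)
  rw [Nat.succPNat_coe] at h
  rw [h, specialize, MvPolynomial.aeval_X, Nat.succPNat_coe]

/-- Newton's identities make p_1 + p_2 T + ⋯ the logarithmic derivative of the first factor, and its
negative is that of the second. The product has derivative 0 and constant term 1. -/
theorem specialize_completeSeries_mul :
    (PowerSeries.mk fun k => specialize d (complete k)) *
      ∏ a : Fin d, (1 - PowerSeries.C (MvPolynomial.X a) * PowerSeries.X) = 1 := by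
  have hH : PowerSeries.derivative _ (PowerSeries.mk fun k => specialize d (complete k)) =
      (PowerSeries.mk fun i => ∑ a : Fin d, MvPolynomial.X a ^ (i + 1)) *
        PowerSeries.mk fun k => specialize d (complete k) := by
    ext1 m
    have h := congrArg (specialize d) (succ_mul_complete m)
    rw [map_mul, map_natCast, map_sum] at h
    rw [PowerSeries.coeff_derivative, PowerSeries.coeff_mk, PowerSeries.coeff_mul,
      Finset.Nat.sum_antidiagonal_eq_sum_range_succ_mk, mul_comm]
    push_cast at h
    rw [h]
    refine Finset.sum_congr rfl fun i _ => ?_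
    rw [map_mul, specialize_psum_succ, PowerSeries.coeff_mk, PowerSeries.coeff_mk]
  refine PowerSeries.derivative.ext ?_ ?_
  · rw [Derivation.leibniz, hH, derivative_prod_one_sub, Derivation.map_one_eq_zero]
    simp only [smul_eq_mul]
    ring
  · rw [map_mul, map_prod]
    simp [complete_zero]

/-- Compare coefficients in 1/(1 - x_a T) = (Σ_k h_k T^k) ∏_{b ≠ a} (1 - x_b T); the product has
degree below d. -/
theorem X_pow_eq_sum (a : Fin d) (e : ℕ) : (MvPolynomial.X a : MvPolynomial (Fin d) ℂ) ^ e =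
    ∑ s ∈ Finset.range d,
      specialize d (completeInt ((e : ℤ) - s)) * (coPoly d a).coeff s := by
  have h1 : (PowerSeries.mk fun i => (MvPolynomial.X a : MvPolynomial (Fin d) ℂ) ^ i) =
      (PowerSeries.mk fun k => specialize d (complete k)) * (coPoly d a : PowerSeries _) := by
    have h2 := mk_pow_mul (MvPolynomial.X a : MvPolynomial (Fin d) ℂ)
    have h3 := specialize_completeSeries_mul d
    rw [← Finset.mul_prod_erase _ _ (Finset.mem_univ a)] at h3
    have h4 : (coPoly d a : PowerSeries _) = ∏ b ∈ Finset.univ.erase a,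
        (1 - PowerSeries.C (MvPolynomial.X b : MvPolynomial (Fin d) ℂ) * PowerSeries.X) := by
      rw [coPoly, ← Polynomial.coeToPowerSeries.ringHom_apply, map_prod]
      simp
    rw [h4]
    have aux (M u H E : PowerSeries (MvPolynomial (Fin d) ℂ)) (h : M * u = 1)
        (h' : H * (u * E) = 1) : M = H * E := by
      linear_combination H * E * h - M * h'
    exact aux _ _ _ _ h2 h3
  have h2 := congrArg (PowerSeries.coeff e) h1
  rw [PowerSeries.coeff_mk, PowerSeries.coeff_mul, ← Finset.Nat.sum_antidiagonal_swap,
    Finset.Nat.sum_antidiagonal_eq_sum_range_succ_mk] at h2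
  have h3 (s : ℕ) (hs : s ∈ Finset.range (e + 1)) : complete (e - s) =
      completeInt ((e : ℤ) - s) := by
    have hs := Finset.mem_range.mp hs
    rw [completeInt, if_neg (by omega)]
    congr 1
    omega
  rw [h2]
  calc _ = ∑ s ∈ Finset.range (e + 1),
        specialize d (completeInt ((e : ℤ) - s)) * (coPoly d a).coeff s := by
        refine Finset.sum_congr rfl fun s hs => ?_
        simp only [Prod.swap, PowerSeries.coeff_mk, Polynomial.coeff_coe]
        rw [h3 s hs]
    _ = ∑ s ∈ Finset.range (e + 1 + d),
        specialize d (completeInt ((e : ℤ) - s)) * (coPoly d a).coeff s := by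
        refine Finset.sum_subset (Finset.range_subset_range.mpr (by omega)) fun s _ hs => ?_
        have : ¬ s < e + 1 := fun h => hs (Finset.mem_range.mpr h)
        rw [completeInt, if_pos (by omega), map_zero, zero_mul]
    _ = _ := by
        refine (Finset.sum_subset (Finset.range_subset_range.mpr (by omega)) fun s _ hs => ?_).symm
        rw [coPoly_coeff_eq_zero d a (not_lt.mp fun h => hs (Finset.mem_range.mpr h)), mul_zero]

variable {d}

theorem rowLen_eq_zero_of_colLen_le {lam : YoungDiagram} {i : ℕ} (hi : lam.colLen 0 ≤ i) :
    lam.rowLen i = 0 := by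
  by_contra h
  have := YoungDiagram.mem_iff_lt_colLen.mp
    (YoungDiagram.mem_iff_lt_rowLen.mpr (Nat.pos_of_ne_zero h))
  omega

theorem schur_eq_det {lam : YoungDiagram} (hc : lam.colLen 0 ≤ d) : schur lam =
    Matrix.det (Matrix.of fun i j : Fin d =>
      completeInt ((lam.rowLen i : ℤ) + (j : ℤ) - (i : ℤ))) :=
  (det_extend (fun i j => completeInt ((lam.rowLen i : ℤ) + (j : ℤ) - (i : ℤ))) hc
    (fun i j hi hj => by
      rw [rowLen_eq_zero_of_colLen_le hi, completeInt, if_pos (by push_cast; omega)])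
    (fun i hi => by
      rw [rowLen_eq_zero_of_colLen_le hi]
      simp [completeInt, complete_zero])).symm

/-- By `X_pow_eq_sum` the matrix factors as the Jacobi-Trudi matrix of λ times a matrix independent
of λ. The exponents are listed in increasing order, hence the row reversal. For λ = ∅ the formula
identifies the remaining factor with the Vandermonde determinant. -/
theorem det_X_pow_mayaSeq {lam : YoungDiagram} (hc : lam.colLen 0 ≤ d) :
    Matrix.det (Matrix.of fun i a : Fin d =>
        (MvPolynomial.X a : MvPolynomial (Fin d) ℂ) ^ mayaSeq d lam i) =
      specialize d (schur lam) * ((Equiv.Perm.sign (Fin.revPerm : Equiv.Perm (Fin d)) : ℤˣ) : ℤ) *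
        Matrix.det (Matrix.of fun j a : Fin d => (coPoly d a).coeff (d - 1 - j)) := by
  have h1 : (Matrix.of fun i a : Fin d =>
      (MvPolynomial.X a : MvPolynomial (Fin d) ℂ) ^ mayaSeq d lam i) =
      ((specialize d).mapMatrix (Matrix.of fun i j : Fin d =>
        completeInt ((lam.rowLen i : ℤ) + (j : ℤ) - (i : ℤ)))).submatrix Fin.revPerm id *
      Matrix.of fun j a : Fin d => (coPoly d a).coeff (d - 1 - j) := by
    ext1 i a
    rw [Matrix.mul_apply, Matrix.of_apply, X_pow_eq_sum, ← Finset.sum_range_reflect,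
      Finset.sum_range]
    refine Finset.sum_congr rfl fun j _ => ?_
    simp only [AlgHom.mapMatrix_apply, Matrix.submatrix_apply, Matrix.map_apply, Matrix.of_apply,
      id, Fin.revPerm_apply, Fin.val_rev]
    have hi := i.2
    have hj := j.2
    rw [mayaSeq, if_pos hi, show d - ((i : ℕ) + 1) = d - 1 - i by omega]
    congr 3
    push_cast
    omega
  rw [h1, Matrix.det_mul, Matrix.det_permute, schur_eq_det hc, AlgHom.map_det,
    mul_comm (Matrix.det ((specialize d).mapMatrix _))]

theorem schur_bot : schur ⊥ = 1 := by
  have : (⊥ : YoungDiagram).colLen 0 = 0 := by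
    rw [YoungDiagram.colLen_eq_card]
    simp [YoungDiagram.col]
  rw [schur_eq_det this.le, Matrix.det_isEmpty]

theorem mayaSeq_bot (i : Fin d) : mayaSeq d ⊥ i = i := by
  have : (⊥ : YoungDiagram).rowLen (d - 1 - i) = 0 := by
    rw [YoungDiagram.rowLen_eq_card]
    simp [YoungDiagram.row]
  rw [mayaSeq, if_pos i.2, this, zero_add]

theorem perp_kappa_schur (c : ℕ) {lam : YoungDiagram} (hc : lam.colLen 0 ≤ d) :
    perp (kappa d (schur lam)) (flagDet d c fun a => zetaSeq Lam a * baseSeries d) =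
      flagDet d c fun a => zetaSeq Lam (mayaSeq d lam a) * baseSeries d := by
  have h0 : (d.factorial : ℂ) ≠ 0 := Nat.cast_ne_zero.mpr d.factorial_ne_zero
  have hbot := det_X_pow_mayaSeq (d := d) (lam := ⊥) (by
    rw [YoungDiagram.colLen_eq_card]; simp [YoungDiagram.col])
  rw [schur_bot, map_one, one_mul] at hbot
  simp only [mayaSeq_bot] at hbot
  refine smul_right_injective Lam h0 ?_
  dsimp only
  rw [← map_smul, ← alternantMap_det d c (fun i => mayaSeq d lam i), ← alternantMap_det d c (fun i => i),
    perp_kappa_alternantMap, det_X_pow_mayaSeq hc, hbot, mul_assoc]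

end Bialternant

/-! ### Dual stable Grothendieck polynomials of rectangles. -/

section Rectangle

variable {d c : ℕ}

theorem mem_rectangle {i j : ℕ} : (i, j) ∈ rectangle d c ↔ i < d ∧ j < c := by
  rw [← YoungDiagram.mem_cells]
  simp [rectangle]

theorem rowLen_rectangle {i : ℕ} (hi : i < d) : (rectangle d c).rowLen i = c := by
  refine le_antisymm (not_lt.mp fun h => ?_) (not_lt.mp fun h => ?_)
  · exact lt_irrefl _ (mem_rectangle.mp (YoungDiagram.mem_iff_lt_rowLen.mpr h)).2
  · exact lt_irrefl _ (YoungDiagram.mem_iff_lt_rowLen.mp (mem_rectangle.mpr ⟨hi, h⟩))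

theorem colLen_rectangle {j : ℕ} (hj : j < c) : (rectangle d c).colLen j = d := by
  refine le_antisymm (not_lt.mp fun h => ?_) (not_lt.mp fun h => ?_)
  · exact lt_irrefl _ (mem_rectangle.mp (YoungDiagram.mem_iff_lt_colLen.mpr h)).1
  · exact lt_irrefl _ (YoungDiagram.mem_iff_lt_colLen.mp (mem_rectangle.mpr ⟨h, hj⟩))

theorem rowLen_le_of_le_rectangle {lam : YoungDiagram} (h : lam ≤ rectangle d c) :
    lam.rowLen 0 ≤ c := not_lt.mp fun h' =>
  lt_irrefl _ (mem_rectangle.mp (h (YoungDiagram.mem_iff_lt_rowLen.mpr h'))).2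

theorem colLen_le_of_le_rectangle {lam : YoungDiagram} (h : lam ≤ rectangle d c) :
    lam.colLen 0 ≤ d := not_lt.mp fun h' =>
  lt_irrefl _ (mem_rectangle.mp (h (YoungDiagram.mem_iff_lt_colLen.mpr h'))).1

end Rectangle

section DualGrothendieck

variable {d c : ℕ}

theorem coordForm_append_sum_smul {R : Type*} [CommRing R] (U : Matrix (Fin d) (Fin d) R)
    (V : Matrix (Fin c) (Fin c) R) (f : Fin d → R⟦X⟧) (g : Fin c → R⟦X⟧) :
    coordForm R (d + c) (Fin.append (fun j => ∑ k, U k j • f k) fun j => ∑ k, V k j • g k) =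
      U.det * V.det * coordForm R (d + c) (Fin.append f g) := by
  have h := coordForm_sum_smul
    ((Matrix.fromBlocks U 0 0 V).submatrix finSumFinEquiv.symm finSumFinEquiv.symm)
    (Fin.append f g)
  rw [Matrix.det_submatrix_equiv_self, Matrix.det_fromBlocks_zero₂₁] at h
  rw [← h]
  refine congrArg _ (funext fun j => ?_)
  rw [Fin.sum_univ_add]
  refine Fin.addCases (fun i => ?_) (fun i => ?_) j
  · simp
  · simp

/-- The entries of the determinant defining `g_λ`. -/
def dualGrothEntry (r i j : ℕ) : Lam :=
  ∑ m ∈ Finset.range (r + j + 1), (((-1) ^ m * Ring.choose (-(i : ℤ)) m : ℤ) : Lam) *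
    completeInt ((r : ℤ) + (j : ℤ) - (i : ℤ) - (m : ℤ))

theorem completeInt_of_neg {k : ℤ} (hk : k < 0) : completeInt k = 0 := if_pos hk

theorem completeInt_natCast (k : ℕ) : completeInt k = complete k := by
  rw [completeInt, if_neg (by omega), Int.toNat_natCast]

theorem dualGroth_eq_det {lam : YoungDiagram} (hc : lam.colLen 0 ≤ d) : dualGroth lam =
    Matrix.det (Matrix.of fun i j : Fin d => dualGrothEntry (lam.rowLen i) i j) :=
  (det_extend (fun i j => dualGrothEntry (lam.rowLen i) i j) hc
    (fun i j hi hj => by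
      rw [rowLen_eq_zero_of_colLen_le hi, dualGrothEntry]
      exact Finset.sum_eq_zero fun m _ => by
        rw [completeInt_of_neg (by push_cast; omega), mul_zero])
    (fun i hi => by
      rw [rowLen_eq_zero_of_colLen_le hi, dualGrothEntry, Finset.sum_eq_single 0]
      · simp [completeInt, complete_zero]
      · intro m _ hm
        rw [completeInt_of_neg (by push_cast; omega), mul_zero]
      · simp)).symm

/-- Identifies the coordinates of X^i ζ^{-i} Σ (-1)^k h_k X^k with the entries defining g. For c + j
< i both sides vanish, and the surplus terms of the defining sum have negative index. -/
theorem coeff_X_pow_mul_completeSeries (i j : ℕ) :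
    PowerSeries.coeff (c + j) (PowerSeries.X ^ i *
      (PowerSeries.binomialSeries Lam (-(i : ℤ)) * completeSeries)) =
      (-1) ^ (c + j + i) * dualGrothEntry c i j := by
  rw [PowerSeries.coeff_X_pow_mul', dualGrothEntry]
  split_ifs with h
  · obtain ⟨p, hp⟩ := Nat.exists_eq_add_of_le h
    rw [PowerSeries.coeff_mul, Finset.Nat.sum_antidiagonal_eq_sum_range_succ_mk, Finset.mul_sum,
      ← Finset.sum_subset (Finset.range_subset_range.mpr
        (show (c + j - i).succ ≤ c + j + 1 by omega))]
    · refine Finset.sum_congr rfl fun m hm => ?_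
      have hm := Finset.mem_range.mp hm
      obtain ⟨q, hq⟩ : ∃ q, p = m + q := Nat.exists_eq_add_of_le (by omega)
      have h1 : ((c : ℤ) + j - i - m) = (q : ℕ) := by omega
      have h2 : c + j - i - m = q := by omega
      have h3 : (-1 : Lam) ^ (c + j + i) * (-1) ^ m = (-1) ^ q := by
        rw [hp, hq, ← pow_add, show i + (m + q) + i + m = 2 * (i + m) + q by ring, pow_add, pow_mul]
        simp
      simp only
      rw [h1, completeInt_natCast, PowerSeries.binomialSeries_coeff, h2, completeSeries,
        PowerSeries.coeff_mk, zsmul_eq_mul, mul_one, ← h3]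
      push_cast
      ring
    · intro m _ hm
      have : ¬ m < (c + j - i).succ := fun h => hm (Finset.mem_range.mpr h)
      rw [completeInt_of_neg (by omega), mul_zero, mul_zero]
  · rw [Finset.sum_eq_zero, mul_zero]
    intro m _
    rw [completeInt_of_neg (by omega), mul_zero]

theorem baseSeries_eq (i : ℕ) (hi : i < d) : zetaSeq Lam (d - 1 - i) * baseSeries d =
    PowerSeries.binomialSeries Lam (-(i : ℤ)) * completeSeries := by
  rw [baseSeries, zetaSeq_eq_binomialSeries, ← mul_assoc, ← PowerSeries.binomialSeries_add]
  congr 2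
  push_cast [Nat.cast_sub (show i ≤ d - 1 by omega), Nat.cast_sub (show 1 ≤ d by omega)]
  ring

theorem one_add_X_pow_eq_sum {R : Type*} [CommRing R] (a e : ℕ) (ha : a ≤ e) :
    (1 + PowerSeries.X : R⟦X⟧) ^ a = ∑ k : Fin (e + 1), ((a.choose k : ℕ) : R) • PowerSeries.X ^ (k : ℕ) := by
  rw [add_comm, add_pow, ← Finset.sum_range fun k => ((a.choose k : ℕ) : R) • (PowerSeries.X : R⟦X⟧) ^ k]
  refine (Finset.sum_subset (Finset.range_subset_range.mpr (show a + 1 ≤ e + 1 by omega))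
    fun k _ hk => ?_).trans (Finset.sum_congr rfl fun k _ => ?_)
  · have : ¬ k < a + 1 := fun h => hk (Finset.mem_range.mpr h)
    rw [Nat.choose_eq_zero_of_lt (by omega), Nat.cast_zero, mul_zero]
  · rw [PowerSeries.smul_eq_C_mul, map_natCast]
    ring

theorem zetaSeq_eq_sum {R : Type*} [CommRing R] {e : ℕ} (a : Fin e) :
    zetaSeq R a = ∑ k : Fin e, (((a : ℕ).choose k : ℕ) : R) • PowerSeries.X ^ (k : ℕ) := by
  obtain ⟨e, rfl⟩ : ∃ e', e = e' + 1 := ⟨e - 1, by have := a.pos; omega⟩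
  exact one_add_X_pow_eq_sum _ _ (Nat.le_of_lt_succ a.2)

theorem X_pow_mul_zetaSeq_eq_sum {R : Type*} [CommRing R] {e : ℕ} (a : Fin e) :
    PowerSeries.X ^ (a : ℕ) * zetaSeq R (e - 1 - a) =
      ∑ k : Fin e, (if a ≤ k then (((e - 1 - a).choose (k - a) : ℕ) : R) else 0) •
        PowerSeries.X ^ (k : ℕ) := by
  have ha := a.2
  rw [zetaSeq, one_add_X_pow_eq_sum (e - 1 - a) (e - 1 - a) le_rfl,
    ← Finset.sum_range fun k => (((e - 1 - a).choose k : ℕ) : R) • (PowerSeries.X : R⟦X⟧) ^ k,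
    Finset.mul_sum]
  have h := Finset.sum_range (n := e) fun k => (if (a : ℕ) ≤ k then
    (((e - 1 - a).choose (k - a) : ℕ) : R) else 0) • (PowerSeries.X : R⟦X⟧) ^ k
  have he : Finset.range e = Finset.range (a + (e - 1 - a + 1)) := congrArg _ (by omega)
  refine Eq.trans ?_ h
  rw [he, Finset.sum_range_add _ (a : ℕ), Finset.sum_eq_zero (s := Finset.range a), zero_add]
  · refine Finset.sum_congr rfl fun k _ => ?_
    rw [if_pos (Nat.le_add_right _ _), Nat.add_sub_cancel_left, mul_smul_comm, ← pow_add]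
  · intro k hk
    have := Finset.mem_range.mp hk
    rw [if_neg (by omega), zero_smul]

theorem det_choose (R : Type*) [CommRing R] (e : ℕ) :
    Matrix.det (Matrix.of fun k a : Fin e => (((a : ℕ).choose k : ℕ) : R)) = 1 := by
  rw [Matrix.det_of_isUpperTriangular]
  · simp
  · intro i j hij
    have hij : j < i := hij
    simp [Nat.choose_eq_zero_of_lt (Fin.lt_def.mp hij)]

theorem det_choose_sub (R : Type*) [CommRing R] (e : ℕ) :
    Matrix.det (Matrix.of fun k a : Fin e =>
      if a ≤ k then (((e - 1 - a).choose (k - a) : ℕ) : R) else 0) = 1 := by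
  rw [Matrix.det_of_isLowerTriangular]
  · simp
  · intro i j hij
    have hij : i < j := hij
    simp [not_le.mpr hij]

/-- Both ζ^i and X^i ζ^{d-1-i}, i < d, are unitriangular over X^0, …, X^{d-1}. One family may
replace the other in the first block, and the factor ζ^{1-d} then leaves X^i ζ^{-i}. -/
theorem flagDet_eq_coordForm_X_pow (d c : ℕ) :
    flagDet d c (fun a => zetaSeq Lam a * baseSeries d) =
      coordForm Lam (d + c) (Fin.append (fun i : Fin d => PowerSeries.X ^ (i : ℕ) *
        (PowerSeries.binomialSeries Lam (-(i : ℤ)) * completeSeries))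
          fun k : Fin c => PowerSeries.X ^ (k : ℕ)) := by
  have h1 := coordForm_append_sum_smul
    (Matrix.of fun k a : Fin d => (((a : ℕ).choose k : ℕ) : Lam))
    (Matrix.of fun k a : Fin c => (((a : ℕ).choose k : ℕ) : Lam))
    (fun k : Fin d => PowerSeries.X ^ (k : ℕ) * baseSeries d) fun k : Fin c => PowerSeries.X ^ (k : ℕ)
  have h2 := coordForm_append_sum_smul
    (Matrix.of fun k a : Fin d => if a ≤ k then (((d - 1 - a).choose (k - a) : ℕ) : Lam) else 0)
    (1 : Matrix (Fin c) (Fin c) Lam)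
    (fun k : Fin d => PowerSeries.X ^ (k : ℕ) * baseSeries d) fun k : Fin c => PowerSeries.X ^ (k : ℕ)
  rw [det_choose, det_choose, one_mul, one_mul] at h1
  rw [det_choose_sub, Matrix.det_one, one_mul, one_mul, ← h1] at h2
  simp only [Matrix.of_apply, ← smul_mul_assoc, ← Finset.sum_mul, ← zetaSeq_eq_sum,
    ← X_pow_mul_zetaSeq_eq_sum, mul_assoc] at h2
  rw [flagDet, ← h2]
  refine congrArg _ (congrArg₂ _ (funext fun i => ?_) (funext fun k => ?_))
  · rw [baseSeries_eq i i.2]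
  · simp [Matrix.one_apply]

/-- The columns X^k, k < c, are unit vectors, so only the rows c, …, c+d-1 of the first block
matter; they form the transposed matrix of g up to signs. Moving these rows to the top costs
(-1)^{dc}, which the signs of the entries compensate. -/
theorem dualGroth_rectangle (d c : ℕ) :
    dualGroth (rectangle d c) = flagDet d c fun a => zetaSeq Lam a * baseSeries d := by
  have hr := rowLen_le_of_le_rectangle (le_refl (rectangle d c))
  have hc := colLen_le_of_le_rectangle (le_refl (rectangle d c))
  set M : Matrix (Fin (d + c)) (Fin (d + c)) Lam := Matrix.of fun i j =>
    PowerSeries.coeff (i : ℕ) (Fin.append (fun i : Fin d => PowerSeries.X ^ (i : ℕ) *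
        (PowerSeries.binomialSeries Lam (-(i : ℤ)) * completeSeries))
          (fun k : Fin c => PowerSeries.X ^ (k : ℕ)) j)
  have hperm := Matrix.det_permute (mayaPerm d c (rectangle d c) hr hc) M
  have hsign : (((∏ i : Fin c, (-1) ^ (rectangle d c).colLen i : ℤˣ) : ℤ) : Lam) =
      (-1) ^ (d * c) := by
    rw [Finset.prod_congr rfl fun i _ => by rw [colLen_rectangle i.2]]
    simp [pow_mul]
  have hleft (j : Fin d) : mayaSeq d (rectangle d c) j = c + j := by
    rw [mayaSeq, if_pos j.2, rowLen_rectangle (by omega)]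
  have hright (k : Fin c) : mayaSeq d (rectangle d c) (d + k) = k := by
    rw [mayaSeq, if_neg (by omega), Nat.add_sub_cancel_left, colLen_rectangle k.2, Nat.sub_self,
      zero_add]
  rw [sign_mayaPerm, hsign, ← Matrix.det_submatrix_equiv_self finSumFinEquiv,
    ← Matrix.fromBlocks_toBlocks ((M.submatrix _ id).submatrix finSumFinEquiv finSumFinEquiv)] at hperm
  have h11 : ((M.submatrix (mayaPerm d c (rectangle d c) hr hc) id).submatrix finSumFinEquiv
      finSumFinEquiv).toBlocks₁₁ = Matrix.of fun j i : Fin d => (-1) ^ (c + (j : ℕ)) *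
        (Matrix.of fun j i : Fin d => (-1) ^ (i : ℕ) * (Matrix.of fun i j : Fin d =>
          dualGrothEntry ((rectangle d c).rowLen i) i j).transpose j i) j i := by
    ext1 j i
    simp only [Matrix.toBlocks₁₁, Matrix.submatrix_apply, Matrix.of_apply, M, coe_mayaPerm, id,
      finSumFinEquiv_apply_left, Fin.append_left, Fin.val_castAdd, hleft, Matrix.transpose_apply]
    rw [coeff_X_pow_mul_completeSeries, rowLen_rectangle i.2, pow_add, mul_assoc]
  have h12 : ((M.submatrix (mayaPerm d c (rectangle d c) hr hc) id).submatrix finSumFinEquiv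
      finSumFinEquiv).toBlocks₁₂ = 0 := by
    ext1 j i
    have : ¬ c + (j : ℕ) = i := by omega
    simp only [Matrix.toBlocks₁₂, Matrix.submatrix_apply, Matrix.of_apply, M, coe_mayaPerm, id,
      finSumFinEquiv_apply_left, finSumFinEquiv_apply_right, Fin.append_right, Fin.val_castAdd,
      hleft, PowerSeries.coeff_X_pow, if_neg this, Matrix.zero_apply]
  have h22 : ((M.submatrix (mayaPerm d c (rectangle d c) hr hc) id).submatrix finSumFinEquiv
      finSumFinEquiv).toBlocks₂₂ = 1 := by
    ext1 j i
    simp only [Matrix.toBlocks₂₂, Matrix.submatrix_apply, Matrix.of_apply, M, coe_mayaPerm, id,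
      finSumFinEquiv_apply_right, Fin.append_right, Fin.val_natAdd, hright, PowerSeries.coeff_X_pow,
      Matrix.one_apply, Fin.ext_iff]
  rw [h11, h12, h22, Matrix.det_fromBlocks_zero₁₂, Matrix.det_one, mul_one, Matrix.det_mul_column,
    Matrix.det_mul_row, Matrix.det_transpose, ← dualGroth_eq_det hc, ← mul_assoc,
    ← Finset.prod_mul_distrib] at hperm
  have hprod : ∏ i : Fin d, ((-1 : Lam) ^ (c + (i : ℕ)) * (-1) ^ (i : ℕ)) = (-1) ^ (d * c) := by
    have h (i : Fin d) : (-1 : Lam) ^ (c + (i : ℕ)) * (-1) ^ (i : ℕ) = (-1) ^ c := by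
      rw [pow_add, mul_assoc, ← pow_add, ← two_mul, pow_mul (-1 : Lam) 2]
      simp
    rw [Finset.prod_congr rfl fun i _ => h i, Finset.prod_const, Finset.card_univ, Fintype.card_fin,
      ← pow_mul, mul_comm]
  rw [hprod] at hperm
  rw [flagDet_eq_coordForm_X_pow, coordForm_apply]
  exact (isUnit_one.neg.pow (d * c)).mul_left_cancel hperm

end DualGrothendieck

/-! ### Comparison of D, τ and σ with the determinants above. -/

section Determinants

theorem map_zetaSeq {R S : Type*} [CommRing R] [CommRing S] (f : R →+* S) (j : ℕ) :
    PowerSeries.map f (zetaSeq R j) = zetaSeq S j := by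
  simp

theorem map_sigmaDet {R S : Type*} [CommRing R] [CommRing S] (f : R →+* S) (n : ℕ) (ψ : R⟦X⟧)
    (m : ℕ) : f (sigmaDet n ψ m) = sigmaDet n (PowerSeries.map f ψ) m := by
  rw [sigmaDet, mixedDet, map_coordForm]
  refine congrArg _ (funext fun j => ?_)
  split_ifs
  · rw [map_mul, map_zetaSeq]
  · rw [map_zetaSeq]

theorem map_tauDet {R S : Type*} [CommRing R] [CommRing S] (f : R →+* S) (n : ℕ) (ψ : R⟦X⟧)
    (m : ℕ) : f (tauDet n ψ m) = tauDet n (PowerSeries.map f ψ) m := by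
  rw [tauDet, map_sigmaDet, map_mul]
  simp

theorem zetaPow_natCast (n j : ℕ) : zetaPow n (j : ℤ) = zetaSeq (LamN n) j :=
  (zetaSeq_eq_binomialSeries _ _).symm

theorem zetaPow_add (n : ℕ) (a b : ℤ) : zetaPow n (a + b) = zetaPow n a * zetaPow n b :=
  PowerSeries.binomialSeries_add _ _

theorem sigma_eq (n i : ℕ) : sigma n i = sigmaDet n (phi n) i := by
  rw [sigma, coordDet_eq]
  simp only [zetaPow_natCast]
  rfl

theorem tau_eq (n i : ℕ) : tau n i = tauDet n (phi n) i := by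
  rw [tau]
  cases i with
  | zero =>
    rw [if_pos rfl]
    exact (coordForm_one_add_X_pow n).symm
  | succ m =>
    rw [if_neg (Nat.succ_ne_zero m), coordDet_eq, tauDet_succ_eq]
    refine congrArg _ (funext fun j => ?_)
    split_ifs with h
    · rw [zetaPow_natCast]
    · rw [← zetaPow_natCast, Nat.cast_sub (by omega), Nat.cast_one]

theorem constantCoeff_phi {n : ℕ} (hn : 1 ≤ n) : PowerSeries.constantCoeff (phi n) = 1 := by
  rw [phi, ← PowerSeries.coeff_zero_eq_constantCoeff_apply, PowerSeries.coeff_mk, pow_zero, one_mul,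
    hN, dif_pos (by omega)]
  exact Subtype.ext complete_zero

theorem sigmaDet_self {R : Type*} [CommRing R] (n : ℕ) {ψ : R⟦X⟧}
    (hψ : PowerSeries.constantCoeff ψ = 1) : sigmaDet n ψ n = 1 := by
  rw [← coordForm_zetaSeq_mul n ψ hψ]
  exact congrArg _ (funext fun j => if_pos j.2)

theorem sigmaDet_zero {R : Type*} [CommRing R] (n : ℕ) (ψ : R⟦X⟧) : sigmaDet n ψ 0 = 1 :=
  coordForm_one_add_X_pow n

/-- All columns are multiplied by ζ^d, which removes the negative exponents and moves 1, …, ζ^{c-1}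
to ζ^d, …, ζ^{n-1}. -/
theorem bigD_eq {d c : ℕ} {θ : Fin d → ℤ} {e : ℕ → ℕ} (h : ∀ a : Fin d, -θ a = e a + 1 - d) :
    bigD (d + c) d θ = coordForm (LamN (d + c)) (d + c) fun j => if (j : ℕ) < d then
      zetaSeq _ (e j) * ((1 + PowerSeries.X) * phi (d + c)) else zetaSeq _ j := by
  rw [bigD, coordDet_eq, ← coordForm_mul_left (zetaSeq _ d) (by simp)]
  refine congrArg _ (funext fun j => ?_)
  split_ifs with hj
  · have h1 : (1 + PowerSeries.X) ^ (e j + 1) = zetaPow (d + c) ((e j + 1 : ℕ) : ℤ) :=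
      (zetaPow_natCast _ _).symm
    rw [h, ← mul_assoc, ← mul_assoc, ← zetaPow_natCast, ← zetaPow_add, ← pow_succ, h1]
    congr 2
    push_cast
    ring
  · rw [← zetaPow_natCast, ← zetaPow_natCast, ← zetaPow_add]
    congr 1
    ring

/-- The truncated φ and the full series agree modulo X^n, and the coordinate determinant sees
nothing more. -/
theorem coe_bigD {d c : ℕ} {θ : Fin d → ℤ} {e : ℕ → ℕ} (h : ∀ a : Fin d, -θ a = e a + 1 - d) :
    ((bigD (d + c) d θ : LamN (d + c)) : Lam) =
      flagDet d c fun a => zetaSeq Lam (e a) * baseSeries d := by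
  have hmap (k : ℤ) : PowerSeries.map (LamN (d + c)).val.toRingHom (zetaPow (d + c) k) =
      PowerSeries.binomialSeries Lam k := by
    ext i : 1
    rw [PowerSeries.coeff_map, zetaPow, PowerSeries.binomialSeries_coeff,
      PowerSeries.binomialSeries_coeff, map_zsmul, map_one]
  have hphi : PowerSeries.X ^ (d + c) ∣
      PowerSeries.map (LamN (d + c)).val.toRingHom (phi (d + c)) - completeSeries := by
    rw [PowerSeries.X_pow_dvd_iff]
    intro m hm
    rw [map_sub, PowerSeries.coeff_map, phi, completeSeries, PowerSeries.coeff_mk,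
      PowerSeries.coeff_mk, hN, dif_pos hm, map_mul, map_pow, map_neg, map_one]
    exact sub_self _
  have h1 := map_coordForm (LamN (d + c)).val.toRingHom (d + c) (fun j : Fin (d + c) =>
    if hj : (j : ℕ) < d then zetaPow (d + c) (-θ ⟨j, hj⟩) * phi (d + c)
    else zetaPow (d + c) ((j : ℤ) - (d : ℤ)))
  rw [← coordDet_eq] at h1
  refine h1.trans (coordForm_congr fun j => ?_)
  refine Fin.addCases (fun a => ?_) (fun k => ?_) j
  · rw [Fin.append_left, dif_pos (show ((Fin.castAdd c a : Fin (d + c)) : ℕ) < d from a.2), map_mul,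
      hmap, baseSeries, ← mul_assoc, zetaSeq_eq_binomialSeries, ← PowerSeries.binomialSeries_add]
    have : -θ ⟨(Fin.castAdd c a : Fin (d + c)), a.2⟩ = (e a : ℤ) + (1 - d) := (h a).trans (by ring)
    rw [this, ← mul_sub]
    exact hphi.mul_left _
  · rw [Fin.append_right, dif_neg (by simp), hmap, zetaSeq_eq_binomialSeries]
    simp

end Determinants

/-! ### The Peterson map. -/

section PetersonMap

variable (n : ℕ)

/-- The image of `z_i` under the Peterson map. -/
def zImage (i : ℕ) : KLoc n :=
  toKLoc n (tau n i * sigma n (i - 1)) * Ring.inverse (toKLoc n (sigma n i * tau n (i - 1)))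

/-- The image of `Q_i` under the Peterson map. -/
def QImage (i : ℕ) : KLoc n :=
  if i < n then toKLoc n (tau n (i - 1) * tau n (i + 1)) * Ring.inverse (toKLoc n (tau n i ^ 2))
  else 0

/-- The Peterson map on polynomials. -/
def petersonPoly : Poly n →ₐ[ℂ] KLoc n :=
  MvPolynomial.aeval (Sum.elim (fun j => zImage n (j + 1)) fun j => QImage n (j + 1))

variable {n}

theorem isUnit_toKLoc (hn : 1 ≤ n) {i : ℕ} (hi : i ≤ n) :
    IsUnit (toKLoc n (tau n i)) ∧ IsUnit (toKLoc n (sigma n i)) := by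
  rcases Nat.eq_zero_or_pos i with rfl | h0
  · rw [tau_eq, sigma_eq, tauDet, sigmaDet_zero, sigmaDet_zero, map_one]
    exact ⟨isUnit_one, isUnit_one⟩
  rcases hi.eq_or_lt with rfl | h1
  · rw [tau_eq, sigma_eq, tauDet, sigmaDet_self _ (by simp [constantCoeff_phi hn]),
      sigmaDet_self _ (constantCoeff_phi hn), map_one]
    exact ⟨isUnit_one, isUnit_one⟩
  · have h (f : LamN n) (hf : f = tau n i ∨ f = sigma n i) : IsUnit (toKLoc n f) :=
      IsLocalization.map_units (M := Submonoid.closure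
        {f : LamN n | ∃ i, 1 ≤ i ∧ i < n ∧ (f = tau n i ∨ f = sigma n i)}) (KLoc n)
        ⟨f, Submonoid.subset_closure ⟨i, h0, h1, hf⟩⟩
    exact ⟨h _ (Or.inl rfl), h _ (Or.inr rfl)⟩

theorem zImage_mul (hn : 1 ≤ n) {i : ℕ} (hi : i ≤ n) :
    zImage n i * toKLoc n (sigma n i * tau n (i - 1)) = toKLoc n (tau n i * sigma n (i - 1)) := by
  have hu : IsUnit (toKLoc n (sigma n i * tau n (i - 1))) := by
    rw [map_mul]
    exact (isUnit_toKLoc hn hi).2.mul (isUnit_toKLoc hn (by omega)).1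
  rw [zImage, mul_assoc, Ring.inverse_mul_cancel _ hu, mul_one]

theorem QImage_mul (hn : 1 ≤ n) {i : ℕ} (hi : i < n) :
    QImage n i * toKLoc n (tau n i ^ 2) = toKLoc n (tau n (i - 1) * tau n (i + 1)) := by
  have hu : IsUnit (toKLoc n (tau n i ^ 2)) := by
    rw [map_pow]
    exact (isUnit_toKLoc hn hi.le).1.pow 2
  rw [QImage, if_pos hi, mul_assoc, Ring.inverse_mul_cancel _ hu, mul_one]

theorem petersonPoly_zvar {j : ℕ} (h1 : 1 ≤ j) (hj : j ≤ n) :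
    petersonPoly n (zvar n j) = zImage n j := by
  rw [zvar, dif_pos ⟨h1, hj⟩, petersonPoly, MvPolynomial.aeval_X]
  simp only [Sum.elim_inl]
  rw [Nat.sub_add_cancel h1]

theorem petersonPoly_Qvar {j : ℕ} (h1 : 1 ≤ j) : petersonPoly n (Qvar n j) = QImage n j := by
  rw [Qvar]
  split_ifs with h
  · rw [petersonPoly, MvPolynomial.aeval_X]
    simp only [Sum.elim_inr]
    rw [Nat.sub_add_cancel h1]
  · rw [map_zero, QImage, if_neg fun h' => h ⟨h1, h'⟩]

theorem petersonPoly_Fpoly {m : ℕ} (hm : m ≤ n) (k : ℤ) :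
    petersonPoly n (Fpoly n m k) = todaF (zImage n) (QImage n) m k := by
  rw [Fpoly, todaF, map_sum]
  refine Finset.sum_congr rfl fun I hI => ?_
  have hI (j : ℕ) (hj : j ∈ I) : 1 ≤ j ∧ j ≤ m :=
    Finset.mem_Icc.mp (Finset.mem_powerset.mp (Finset.mem_filter.mp hI).1 hj)
  rw [map_mul, map_prod, map_prod]
  congr 1
  · exact Finset.prod_congr rfl fun j hj =>
      petersonPoly_zvar (hI j hj).1 ((hI j hj).2.trans hm)
  · refine Finset.prod_congr rfl fun j hj => ?_
    rw [map_sub, map_one, petersonPoly_Qvar (hI j (Finset.mem_filter.mp hj).1).1]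

/-- The series `φ` over the localization. -/
def phiLoc (n : ℕ) : (KLoc n)⟦X⟧ := PowerSeries.map (toKLoc n) (phi n)

theorem toKLoc_tau (m : ℕ) : toKLoc n (tau n m) = tauDet n (phiLoc n) m := by
  rw [tau_eq, map_tauDet, phiLoc]

theorem toKLoc_sigma (m : ℕ) : toKLoc n (sigma n m) = sigmaDet n (phiLoc n) m := by
  rw [sigma_eq, map_sigmaDet, phiLoc]

theorem constantCoeff_phiLoc (hn : 1 ≤ n) : PowerSeries.constantCoeff (phiLoc n) = 1 := by
  rw [phiLoc, ← PowerSeries.coeff_zero_eq_constantCoeff_apply, PowerSeries.coeff_map,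
    PowerSeries.coeff_zero_eq_constantCoeff_apply, constantCoeff_phi hn, map_one]

theorem isUnit_sigmaDet_phiLoc (hn : 1 ≤ n) (m : ℕ) (hm : m ≤ n) :
    IsUnit (sigmaDet n (phiLoc n) m) := by
  rw [← toKLoc_sigma]
  exact (isUnit_toKLoc hn hm).2

theorem isUnit_tauDet_phiLoc (hn : 1 ≤ n) (m : ℕ) (hm : m ≤ n) :
    IsUnit (tauDet n (phiLoc n) m) := by
  rw [← toKLoc_tau]
  exact (isUnit_toKLoc hn hm).1

theorem zImage_succ_mul (hn : 1 ≤ n) (m : ℕ) (hm : m < n) :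
    zImage n (m + 1) * (tauDet n (phiLoc n) m * sigmaDet n (phiLoc n) (m + 1)) =
      tauDet n (phiLoc n) (m + 1) * sigmaDet n (phiLoc n) m := by
  have h := zImage_mul hn (i := m + 1) hm
  rw [map_mul, map_mul, Nat.add_sub_cancel, toKLoc_tau, toKLoc_tau, toKLoc_sigma, toKLoc_sigma] at h
  rw [← h, mul_comm (tauDet n (phiLoc n) m)]

theorem QImage_succ_mul (hn : 1 ≤ n) (m : ℕ) (hm : m + 1 < n) :
    QImage n (m + 1) * tauDet n (phiLoc n) (m + 1) ^ 2 =
      tauDet n (phiLoc n) m * tauDet n (phiLoc n) (m + 2) := by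
  have h := QImage_mul hn hm
  rw [map_mul, map_pow, Nat.add_sub_cancel, toKLoc_tau, toKLoc_tau, toKLoc_tau] at h
  exact h

theorem petersonPoly_uniIdeal (hn : 1 ≤ n) (f : Poly n) (hf : f ∈ uniIdeal n) :
    petersonPoly n f = 0 := by
  have h : uniIdeal n ≤ RingHom.ker (petersonPoly n) := by
    rw [uniIdeal, Ideal.span_le]
    rintro _ ⟨i, -, hi, rfl⟩
    have hφ : IsUnit (phiLoc n) := by
      rw [PowerSeries.isUnit_iff_constantCoeff, constantCoeff_phiLoc hn]
      exact isUnit_one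
    rw [SetLike.mem_coe, RingHom.mem_ker, map_sub, map_natCast, petersonPoly_Fpoly le_rfl,
      todaF_eq_choose hn hφ (isUnit_sigmaDet_phiLoc hn) (isUnit_tauDet_phiLoc hn)
        (zImage_succ_mul hn) (QImage_succ_mul hn) (if_neg (lt_irrefl n)) hi, sub_self]
  exact h hf

/-- The image of Q_j times τ_j^2 is τ_{j-1} τ_{j+1}, a unit; this lets the map extend to the
localization at the Q_j. -/
theorem isUnit_petersonPoly_prod (hn : 1 ≤ n) :
    IsUnit (petersonPoly n (∏ j ∈ Finset.Ico 1 n, Qvar n j)) := by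
  rw [map_prod]
  refine Finset.prod_induction _ IsUnit (fun _ _ => IsUnit.mul) isUnit_one fun j hj => ?_
  obtain ⟨h1, h2⟩ := Finset.mem_Ico.mp hj
  rw [petersonPoly_Qvar h1]
  refine isUnit_of_mul_isUnit_left (y := toKLoc n (tau n j ^ 2)) ?_
  rw [QImage_mul hn h2, map_mul]
  exact (isUnit_toKLoc hn (by omega)).1.mul (isUnit_toKLoc hn (by omega)).1

/-- The Peterson map. -/
def petersonMap (hn : 1 ≤ n) : QKLoc n →ₐ[ℂ] KLoc n :=
  IsLocalization.liftAlgHom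
    (M := Submonoid.powers (Ideal.Quotient.mk (uniIdeal n) (∏ j ∈ Finset.Ico 1 n, Qvar n j)))
    (f := Ideal.Quotient.liftₐ (uniIdeal n) (petersonPoly n) (petersonPoly_uniIdeal hn)) (by
      rintro ⟨_, k, rfl⟩
      rw [map_pow]
      exact (isUnit_petersonPoly_prod hn).pow k)

theorem petersonMap_toQKLoc (hn : 1 ≤ n) (f : Poly n) :
    petersonMap hn (toQKLoc n f) = petersonPoly n f :=
  IsLocalization.lift_eq _ _

theorem algHom_det {A B ι : Type*} [CommRing A] [CommRing B] [Algebra ℂ A] [Algebra ℂ B]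
    [Fintype ι] [DecidableEq ι] (f : A →ₐ[ℂ] B) (M : Matrix ι ι A) (N : Matrix ι ι B)
    (h : ∀ i j, f (M i j) = N i j) : f M.det = N.det := by
  rw [AlgHom.map_det]
  exact congrArg Matrix.det (Matrix.ext h)

theorem petersonPoly_quantumSchur {d c : ℕ} {lam : YoungDiagram} (hr : lam.rowLen 0 ≤ c) :
    petersonPoly (d + c) (quantumSchur (d + c) d lam) =
      Matrix.det (Matrix.of fun i j : Fin (lam.rowLen 0) => todaF (zImage (d + c)) (QImage (d + c))
        (d + j) ((lam.colLen i : ℤ) - (i : ℤ) + (j : ℤ))) := by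
  have h (i j : Fin (lam.rowLen 0)) := petersonPoly_Fpoly (n := d + c) (m := d + (j : ℕ))
    (by have := j.2; omega) ((lam.colLen i : ℤ) - (i : ℤ) + (j : ℤ))
  rw [quantumSchur]
  exact algHom_det (petersonPoly (d + c)) _ _ h

theorem petersonMap_quantumSchur {d c : ℕ} (hn : 1 ≤ d + c) {lam : YoungDiagram}
    (hr : lam.rowLen 0 ≤ c) (hc : lam.colLen 0 ≤ d) {θ : Fin d → ℤ}
    (hθ : ∀ a : Fin d, -θ a = mayaSeq d lam a + 1 - d) :
    petersonMap hn (toQKLoc (d + c) (quantumSchur (d + c) d lam)) *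
      toKLoc (d + c) (tau (d + c) d) = toKLoc (d + c) (bigD (d + c) d θ) := by
  have h := det_todaF_mul_tauDet (R := KLoc (d + c)) (φ := phiLoc (d + c)) (z := zImage (d + c))
    (Q := QImage (d + c)) hn (constantCoeff_phiLoc hn) (isUnit_sigmaDet_phiLoc hn)
    (isUnit_tauDet_phiLoc hn) (zImage_succ_mul hn) (QImage_succ_mul hn) hr hc
  rw [petersonMap_toQKLoc, petersonPoly_quantumSchur hr, toKLoc_tau, bigD_eq hθ, h]
  refine Eq.trans ?_ (map_coordForm (toKLoc (d + c)) (d + c) _).symm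
  refine congrArg _ (funext fun j => ?_)
  split_ifs with hj
  · rw [map_mul, map_mul, map_zetaSeq, map_add, map_one, PowerSeries.map_X, phiLoc, mayaSeq,
      if_pos hj]
  · rw [map_zetaSeq]

theorem bigD_descending (d c : ℕ) :
    bigD (d + c) d (fun a => (d : ℤ) - 1 - (a : ℤ)) = tau (d + c) d := by
  rw [bigD_eq (e := id) (fun a => by simp only [id]; ring), tau_eq]
  rfl

theorem coe_bigD_descending (d c : ℕ) :
    ((bigD (d + c) d (fun a => (d : ℤ) - 1 - (a : ℤ)) : LamN (d + c)) : Lam) =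
      dualGroth (rectangle d c) := by
  rw [coe_bigD (e := id) (fun a => by simp only [id]; ring), dualGroth_rectangle]
  rfl

end PetersonMap

end KPeterson

end

open KPeterson
theorem mainTheorem8 (n : ℕ) (hn : 1 ≤ n) :
    ∃ Φ : QKLoc n →ₐ[ℂ] KLoc n,
      -- `Φ(z_i) = τ_i σ_{i-1} / (σ_i τ_{i-1})` and `Φ(Q_i) = τ_{i-1} τ_{i+1} / τ_i ^ 2`
      (∀ i : ℕ, i ≤ n → IsUnit (toKLoc n (tau n i)) ∧ IsUnit (toKLoc n (sigma n i))) ∧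
      (∀ i : ℕ, 1 ≤ i → i ≤ n →
        Φ (toQKLoc n (zvar n i)) * toKLoc n (sigma n i * tau n (i - 1)) =
          toKLoc n (tau n i * sigma n (i - 1))) ∧
      (∀ i : ℕ, 1 ≤ i → i < n →
        Φ (toQKLoc n (Qvar n i)) * toKLoc n (tau n i ^ 2) =
          toKLoc n (tau n (i - 1) * tau n (i + 1))) ∧
      ∀ d : ℕ, 1 ≤ d → d ≤ n → ∀ lam : YoungDiagram, lam ≤ rect n d →
        -- `Φ(S^Q_{λ,d}) = D(d - i_1, …, d - i_d) / D(d - 1, …, 0)`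
        (IsUnit (toKLoc n (bigD n d fun a => (d : ℤ) - 1 - (a : ℤ))) ∧
          Φ (toQKLoc n (quantumSchur n d lam)) *
              toKLoc n (bigD n d fun a => (d : ℤ) - 1 - (a : ℤ)) =
            toKLoc n (bigD n d fun a => (d : ℤ) - indexSeq d lam a)) ∧
        -- `κ_d(s_λ)^⊥ · g_{R_d} = D(d - i_1, …, d - i_d)`
        perp (kappa d (schur lam)) (dualGroth (rect n d)) =
          ((bigD n d fun a => (d : ℤ) - indexSeq d lam a : LamN n) : Lam) ∧
        -- `Φ(S^Q_{λ,d}) = (κ_d(s_λ)^⊥ · g_{R_d}) / g_{R_d}`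
        (∃ N G : LamN n,
          (N : Lam) = perp (kappa d (schur lam)) (dualGroth (rect n d)) ∧
          (G : Lam) = dualGroth (rect n d) ∧
          IsUnit (toKLoc n G) ∧
          Φ (toQKLoc n (quantumSchur n d lam)) * toKLoc n G = toKLoc n N) := by
  refine ⟨petersonMap hn, fun i hi => isUnit_toKLoc hn hi, fun i h1 hi => ?_, fun i h1 hi => ?_,
    fun d hd hdn lam hlam => ?_⟩
  · rw [petersonMap_toQKLoc, petersonPoly_zvar h1 hi, zImage_mul hn hi]
  · rw [petersonMap_toQKLoc, petersonPoly_Qvar h1, QImage_mul hn hi]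
  · obtain ⟨c, rfl⟩ := Nat.exists_eq_add_of_le hdn
    rw [rect, Nat.add_sub_cancel_left] at hlam ⊢
    have hr := rowLen_le_of_le_rectangle hlam
    have hc := colLen_le_of_le_rectangle hlam
    -- The exponent i_a - d equals μ_a + 1 - d; the extra 1 is the ζ in ζφ.
    have hθ (a : Fin d) : -((d : ℤ) - indexSeq d lam a) = mayaSeq d lam a + 1 - d := by
      rw [indexSeq, mayaSeq, if_pos a.2]
      push_cast
      ring
    have hunit : IsUnit (toKLoc (d + c) (bigD (d + c) d fun a => (d : ℤ) - 1 - (a : ℤ))) := by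
      rw [bigD_descending]
      exact (isUnit_toKLoc hn hdn).1
    have hquot : petersonMap hn (toQKLoc (d + c) (quantumSchur (d + c) d lam)) *
        toKLoc (d + c) (bigD (d + c) d fun a => (d : ℤ) - 1 - (a : ℤ)) =
          toKLoc (d + c) (bigD (d + c) d fun a => (d : ℤ) - indexSeq d lam a) := by
      rw [bigD_descending]
      exact petersonMap_quantumSchur hn hr hc hθ
    have hperp : perp (kappa d (schur lam)) (dualGroth (rectangle d c)) =
        ((bigD (d + c) d fun a => (d : ℤ) - indexSeq d lam a : LamN (d + c)) : Lam) := by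
      rw [dualGroth_rectangle, perp_kappa_schur c hc, coe_bigD hθ]
    exact ⟨⟨hunit, hquot⟩, hperp, _, _, hperp.symm, coe_bigD_descending d c, hunit, hquot⟩
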